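/- Let $P=ax^4+bx^2+cx+d\in\mathbb{Q}[x]$ be irreducible with Galois group $S_4$ over $\mathbb{Q}$ and with four real roots $x_1>x_2>x_3>x_4$. Put $\mathbb{D}=\prod_{i<j}(x_i-x_j)$ and assume that $\Delta=\mathbb{D}^2$ is an integer. Let $F=\mathbb{Q}(x_1,i\mathbb{D})\subset\mathbb{C}$. There are embeddings $\varphi_1,\dots,\varphi_4:F\to\mathbb{C}$, uniquely determined by $\varphi_j(x_1)=x_j$ and $\varphi_j(i\mathbb{D})=-(-1)^j i\mathbb{D}$. Let $\Lambda\subset\mathbb{C}^4$ be the image of the ring of integers $\mathfrak{o}_F$ under $(\varphi_1,\dots,\varphi_4)$, and let $X=\mathbb{C}^4/\Lambda$, a complex torus with coordinates $z_1,\dots,z_4$. Each $\alpha\in\mathfrak{o}_F$ induces $\pi_\alpha:X\to X$, $(z_j)\mapsto(\varphi_j(\alpha)z_j)$. Put $\mu_j=\prod_{k\ne j}(x_j-x_k)$, $$\omega=\frac{i\mathbb{D}}{\Delta}\sum_{j=1}^4(-1)^{j+1}\mu_j\,dz_j\wedge d\bar z_j,\qquad \theta=\frac1{\mathbb{D}}\,dz_1\wedge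 dz_2\wedge dz_3\wedge dz_4,\qquad \Omega=\frac{\omega^2}{2}+4\,\mathrm{Re}\,\theta,$$ and equip $X$ with the metric $g(u,v)=\omega(u,iv)$. An oriented four-dimensional immersed submanifold is called special Lagrangian (respectively Cayley) if $4\,\mathrm{Re}\,\theta$ (respectively $\Omega$) restricts to it as the Riemannian volume form. Let $$M=\mathbb{D}(dz_1 d\bar z_2 dz_3 d\bar z_4+d\bar z_1 dz_2 d\bar z_3 dz_4),\qquad M'=i(dz_1 d\bar z_2 dz_3 d\bar z_4-d\bar z_1 dz_2 d\bar z_3 dz_4).$$ Theorem (Cayley cycles). Complex conjugation preserves $F$ and induces the antiholomorphic involution $\sigma:X\to X$, $(z_j)\mapsto(\bar z_j)$. Its fixed locus $Y$ is a non-empty compact special Lagrangian (hence Cayley) submanifold, and it is a finite disjoint union of injectively immersed smooth four-tori, each of them special Lagrangian and Cayley; with the resulting orientation $Y$ is regarded as a four-cycle. Let $b=i\mathbb{D}$, $a=1+i\mathbb{D}$, $\bar a=1-i\mathbb{D}$, which are elements of $\mathfrak{o}_F$, and, with pushforward of cycles, let $$C_a=(\pi_a-(1+\Delta)^2)(\pi_b+\Delta^2)Y,\qquad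 C_{\bar a}=(\pi_{\bar a}-(1+\Delta)^2)(\pi_b+\Delta^2)Y .$$ Then: 1. $C_a$ and $C_{\bar a}$ are rational linear combinations of immersed four-tori that are both special Lagrangian and Cayley. 2. $C_a$ and $C_{\bar a}$ have zero integral against every product of four of the forms $dz_j,d\bar z_j$ ($1\le j\le 4$), except possibly those that are, up to sign, $dz_1d\bar z_2dz_3d\bar z_4$ or $d\bar z_1dz_2d\bar z_3dz_4$. 3. The matrix of pairings $$\begin{pmatrix}\int_{C_a}M&\int_{C_a}M'\\ \int_{C_{\bar a}}M&\int_{C_{\bar a}}M'\end{pmatrix}$$ is non-degenerate. 4. There are rational linear combinations of $C_a$ and $C_{\bar a}$ representing $M$ and $M'$ respectively. Here a cycle $C$ represents a closed four-form $\mu$ if the class of $\mu$ is Poincaré dual to $C$, i.e. $\int_C\xi=\int_X\mu\wedge\xi$ for every smooth closed complex-valued four-form $\xi$ on $X$. -/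

import Mathlib

open scoped ContDiff

noncomputable section

namespace CayleyCycles

/-- The universal cover `ℂ⁴`, with coordinates `z₁, …, z₄` (indexed by `Fin 4`, so `z_{j+1}` is the
coordinate of index `j`). -/
abbrev E : Type := Fin 4 → ℂ

/-- Coordinatewise complex conjugation on `ℂ⁴`. -/
def conjE (u : E) : E := fun j => (starRingEnd ℂ) (u j)

/-! ### Translation-invariant forms on `ℂ⁴` -/

/-- The coordinate one-forms: `inl j` gives `dz_j`, and `inr j` gives `d\bar z_j`. -/
def coordForm : Fin 4 ⊕ Fin 4 → E →L[ℝ] ℂ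
  | .inl j => ContinuousLinearMap.proj (R := ℝ) (φ := fun _ : Fin 4 => ℂ) j
  | .inr j => (Complex.conjCLE : ℂ →L[ℝ] ℂ).comp
      (ContinuousLinearMap.proj (R := ℝ) (φ := fun _ : Fin 4 => ℂ) j)

/-- The monomial `dz_{μ₁} ∧ ⋯ ∧ dz_{μ_k}`, i.e. `v ↦ ∑_σ sign σ ∏ᵢ dz_{μᵢ}(v_{σ i})`. -/
def monomial {k : ℕ} (μ : Fin k → Fin 4 ⊕ Fin 4) : E [⋀^Fin k]→L[ℝ] ℂ :=
  ContinuousMultilinearMap.alternatization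
    ((ContinuousMultilinearMap.mkPiAlgebra ℝ (Fin k) ℂ).compContinuousLinearMap
      (fun i => coordForm (μ i)))

/-- The exterior product (sum over shuffles) of two complex-valued alternating forms. -/
def wedge {m n : ℕ} (α : E [⋀^Fin m]→L[ℝ] ℂ) (β : E [⋀^Fin n]→L[ℝ] ℂ) :
    E [⋀^Fin m ⊕ Fin n]→ₗ[ℝ] ℂ :=
  (LinearMap.mul' ℝ ℂ).compAlternatingMap (α.toAlternatingMap.domCoprod β.toAlternatingMap)

/-- The multi-index of `dz₁ ∧ d\bar z₂ ∧ dz₃ ∧ d\bar z₄`. -/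
def etaIdx : Fin 4 → Fin 4 ⊕ Fin 4 := ![.inl 0, .inr 1, .inl 2, .inr 3]

/-- The multi-index of `d\bar z₁ ∧ dz₂ ∧ d\bar z₃ ∧ dz₄`. -/
def etaBarIdx : Fin 4 → Fin 4 ⊕ Fin 4 := ![.inr 0, .inl 1, .inr 2, .inl 3]

/-! ### The data attached to the four real roots -/

/-- `𝔻 = ∏_{i<j} (x_i - x_j)`. -/
def rootDisc (x : Fin 4 → ℝ) : ℝ :=
  (x 0 - x 1) * (x 0 - x 2) * (x 0 - x 3) * (x 1 - x 2) * (x 1 - x 3) * (x 2 - x 3)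

/-- The field `F = ℚ(x₁, i𝔻) ⊆ ℂ`. -/
def cmField (x : Fin 4 → ℝ) : IntermediateField ℚ ℂ :=
  IntermediateField.adjoin ℚ {(x 0 : ℂ), Complex.I * (rootDisc x : ℂ)}

/-- `μ_j = ∏_{k ≠ j} (x_j - x_k)`, the conjugates of `μ₁ = (x₁-x₂)(x₁-x₃)(x₁-x₄)`. -/
def muCoeff (x : Fin 4 → ℝ) (j : Fin 4) : ℝ := ∏ k ∈ Finset.univ.erase j, (x j - x k)

/-- `ω = (i𝔻/Δ) (μ₁ dz₁d\bar z₁ - μ₂ dz₂d\bar z₂ + μ₃ dz₃d\bar z₃ - μ₄ dz₄d\bar z₄)`, where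
`Δ = 𝔻²`. -/
def omegaForm (x : Fin 4 → ℝ) : E [⋀^Fin 2]→L[ℝ] ℂ :=
  ∑ j : Fin 4, (Complex.I * (rootDisc x / rootDisc x ^ 2 * ((-1) ^ (j : ℕ) * muCoeff x j) : ℝ)) •
    monomial ![.inl j, .inr j]

/-- `θ = (1/𝔻) dz₁dz₂dz₃dz₄`. -/
def thetaForm (x : Fin 4 → ℝ) : E [⋀^Fin 4]→L[ℝ] ℂ :=
  ((1 / rootDisc x : ℝ) : ℂ) • monomial (fun j : Fin 4 => .inl j)

/-- The Kähler metric `g(u, v) = ω(u, iv)` (a real number, since `ω` is a real `(1,1)`-form). -/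
def kahlerMetric (x : Fin 4 → ℝ) (u v : E) : ℝ := (omegaForm x ![u, Complex.I • v]).re

/-- The special Lagrangian calibration `4 Re θ`. -/
def slForm (x : Fin 4 → ℝ) : E [⋀^Fin 4]→ₗ[ℝ] ℝ :=
  Complex.reLm.compAlternatingMap ((4 : ℝ) • (thetaForm x).toAlternatingMap)

/-- The Cayley calibration `Ω = ω²/2 + 4 Re θ` (here `ω²` is real, so `ω²/2 = Re (ω²/2)`). -/
def cayleyForm (x : Fin 4 → ℝ) : E [⋀^Fin 4]→ₗ[ℝ] ℝ :=
  Complex.reLm.compAlternatingMap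
    ((1 / 2 : ℝ) • (wedge (omegaForm x) (omegaForm x)).domDomCongr finSumFinEquiv) + slForm x

/-- `M = 𝔻 (dz₁d\bar z₂dz₃d\bar z₄ + d\bar z₁dz₂d\bar z₃dz₄)`. -/
def classM (x : Fin 4 → ℝ) : E [⋀^Fin 4]→L[ℝ] ℂ :=
  (rootDisc x : ℂ) • (monomial etaIdx + monomial etaBarIdx)

/-- `M' = i (dz₁d\bar z₂dz₃d\bar z₄ - d\bar z₁dz₂d\bar z₃dz₄)`. -/
def classM' : E [⋀^Fin 4]→L[ℝ] ℂ :=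
  Complex.I • (monomial etaIdx - monomial etaBarIdx)

/-! ### Calibrated frames -/

/-- The `φ`-calibrated frames for the metric `g`: linearly independent `v₁, …, v₄` such that
`φ(v₁, …, v₄)` is the `g`-volume `√det(g(v_i, v_j))` of the parallelotope they span. -/
def IsCalibratedFrame (g : E → E → ℝ) (φ : E [⋀^Fin 4]→ₗ[ℝ] ℝ) (v : Fin 4 → E) : Prop :=
  LinearIndependent ℝ v ∧ φ v = Real.sqrt (Matrix.of fun i j => g (v i) (v j)).det

/-! ### The torus with complex multiplication -/

section Torus

variable {K : Type} [Field K]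

/-- `z : K → ℂ⁴`, `y ↦ (φ₁(y), …, φ₄(y))`. -/
def coords (φ : Fin 4 → K →+* ℂ) (y : K) : E := fun j => φ j y

/-- The lattice `Λ`: the image of the ring of integers of `K` in `ℂ⁴`. -/
def lattice (φ : Fin 4 → K →+* ℂ) : AddSubgroup E :=
  AddMonoidHom.range
    ({ toFun := fun y => coords φ (y : K)
       map_zero' := by ext j; simp [coords]
       map_add' := by intro y z; ext j; simp [coords] } : NumberField.RingOfIntegers K →+ E)

/-- The complex torus `X = ℂ⁴/Λ`. -/
abbrev CMTorus (φ : Fin 4 → K →+* ℂ) : Type := E ⧸ lattice φ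

/-- The projection `ℂ⁴ → X`. -/
def proj (φ : Fin 4 → K →+* ℂ) (u : E) : CMTorus φ := QuotientAddGroup.mk u

/-- A subset `N` of `X` is a (properly oriented) `φ`-calibrated submanifold of dimension four: near
each point it is cut out by a smooth chart `e` as the preimage of a linear subspace `W`, and each
tangent space `(de_q)⁻¹(W)` is spanned by a calibrated frame. (The orientation is then the one for
which the calibration is positive.) The condition is stated on the preimage of `N` in `ℂ⁴`. -/
def IsCalibratedSubmanifold (ψ : Fin 4 → K →+* ℂ) (g : E → E → ℝ) (φ : E [⋀^Fin 4]→ₗ[ℝ] ℝ)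
    (N : Set (CMTorus ψ)) : Prop :=
  ∀ p : E, proj ψ p ∈ N → ∃ (e : OpenPartialHomeomorph E E) (W : Submodule ℝ E),
    p ∈ e.source ∧ ContDiffOn ℝ ∞ e e.source ∧ ContDiffOn ℝ ∞ e.symm e.target ∧
    (∀ q ∈ e.source, proj ψ q ∈ N ↔ e q ∈ W) ∧
    ∀ q ∈ e.source, proj ψ q ∈ N → ∃ v : Fin 4 → E, IsCalibratedFrame g φ v ∧
      Submodule.span ℝ (Set.range v) = W.comap (fderiv ℝ e q : E →ₗ[ℝ] E)

/-- A smooth map from the standard torus `ℝ⁴/ℤ⁴` to `X`, given by a lift `ℝ⁴ → ℂ⁴`. -/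
structure SmoothTorus (ψ : Fin 4 → K →+* ℂ) where
  toFun : (Fin 4 → ℝ) → E
  smooth : ContDiff ℝ ∞ toFun
  periodic : ∀ (t : Fin 4 → ℝ) (n : Fin 4 → ℤ), toFun (t + fun i => (n i : ℝ)) - toFun t ∈ lattice ψ

namespace SmoothTorus

variable {ψ : Fin 4 → K →+* ℂ}

/-- The partial derivatives of the lift at `t`. -/
def frame (T : SmoothTorus ψ) (t : Fin 4 → ℝ) (i : Fin 4) : E :=
  fderiv ℝ T.toFun t (Pi.single i 1)

/-- The map is an immersion of the oriented torus that is calibrated by `φ`: the pullback of `φ` is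
the volume form of the pullback of `g`. -/
def IsCalibrated (g : E → E → ℝ) (φ : E [⋀^Fin 4]→ₗ[ℝ] ℝ) (T : SmoothTorus ψ) : Prop :=
  ∀ t, IsCalibratedFrame g φ (T.frame t)

/-- The image in `X`. -/
def image (T : SmoothTorus ψ) : Set (CMTorus ψ) := Set.range fun t => proj ψ (T.toFun t)

/-- The induced map `ℝ⁴/ℤ⁴ → X` is injective. -/
def IsInjective (T : SmoothTorus ψ) : Prop :=
  ∀ s t : Fin 4 → ℝ, proj ψ (T.toFun s) = proj ψ (T.toFun t) →
    ∃ n : Fin 4 → ℤ, s = t + fun i => (n i : ℝ)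

/-- The integral of the pullback of a four-form over `ℝ⁴/ℤ⁴`. -/
def integral (T : SmoothTorus ψ) (ξ : E → E [⋀^Fin 4]→L[ℝ] ℂ) : ℂ :=
  ∫ t in Set.Icc (0 : Fin 4 → ℝ) 1, ξ (T.toFun t) (T.frame t)

/-- The composite of the map with `π_α : X → X`, multiplication by the algebraic integer `α`, which
in coordinates is `(z_j) ↦ (φ_j(α) z_j)`. -/
def push (α : NumberField.RingOfIntegers K) (T : SmoothTorus ψ) : SmoothTorus ψ where
  toFun t := coords ψ (α : K) * T.toFun t
  smooth := contDiff_const.mul T.smooth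
  periodic t n := by
    obtain ⟨y, hy⟩ := T.periodic t n
    refine ⟨α * y, ?_⟩
    rw [← mul_sub, ← hy]
    ext j
    simp [coords]

end SmoothTorus

/-- Rational four-cycles: finite rational combinations of smooth maps from the four-torus to `X`. -/
abbrev Cycle (ψ : Fin 4 → K →+* ℂ) : Type := SmoothTorus ψ →₀ ℚ

/-- The pushforward of cycles by `π_α`. -/
def pushCycle (ψ : Fin 4 → K →+* ℂ) (α : NumberField.RingOfIntegers K) :
    Module.End ℚ (Cycle ψ) :=
  Finsupp.lmapDomain ℚ ℚ (SmoothTorus.push α)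

/-- The integration pairing `⟨C, ξ⟩`. -/
def pairing {ψ : Fin 4 → K →+* ℂ} (C : Cycle ψ) (ξ : E → E [⋀^Fin 4]→L[ℝ] ℂ) : ℂ :=
  C.sum fun T q => (q : ℂ) * T.integral ξ

/-- Smooth closed complex-valued four-forms on `X`, as `Λ`-periodic forms on `ℂ⁴`. -/
structure IsClosedForm (ψ : Fin 4 → K →+* ℂ) (ξ : E → E [⋀^Fin 4]→L[ℝ] ℂ) : Prop where
  smooth : ContDiff ℝ ∞ ξ
  periodic : ∀ u : E, ∀ l ∈ lattice ψ, ξ (u + l) = ξ u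
  closed : ∀ u : E, extDeriv ξ u = 0

/-- The oriented real frame `(e₁, …, e₄, ie₁, …, ie₄)` of `ℂ⁴`; it is positive for the complex
orientation (in dimension four) and spans a unit of Lebesgue measure. -/
def stdFrame : Fin 4 ⊕ Fin 4 → E
  | .inl j => Pi.single j 1
  | .inr j => Pi.single j Complex.I

/-- The cycle `C` represents the class of the translation-invariant form `μ`, i.e. the class of `μ`
is Poincaré dual to `C`: `∫_C ξ = ∫_X μ ∧ ξ` for all closed four-forms `ξ` on `X`. The integral over
`X` is computed on a fundamental parallelotope of `Λ`. -/
def Represents {ψ : Fin 4 → K →+* ℂ} (C : Cycle ψ) (μ : E [⋀^Fin 4]→L[ℝ] ℂ) : Prop :=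
  ∃ B : Module.Basis (Fin 8) ℝ E,
    (Submodule.span ℤ (Set.range B)).toAddSubgroup = lattice ψ ∧
    ∀ ξ : E → E [⋀^Fin 4]→L[ℝ] ℂ, IsClosedForm ψ ξ →
      pairing C ξ = ∫ u in ZSpan.fundamentalDomain B, wedge μ (ξ u) stdFrame

/-- The tori `T₁, …, T_n` are injective, have disjoint images, and the union of these is `Y`. -/
def Parametrizes {ψ : Fin 4 → K →+* ℂ} {n : ℕ} (T : Fin n → SmoothTorus ψ) (Y : Set (CMTorus ψ)) : Prop :=
  (∀ k, (T k).IsInjective) ∧ (Pairwise fun k l => Disjoint (T k).image (T l).image) ∧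
    ⋃ k, (T k).image = Y

/-- The operator `(π_α - (1 + Δ)²)(π_β + Δ²)` on rational cycles. -/
def cycleOperator (ψ : Fin 4 → K →+* ℂ) (Δ : ℤ) (α β : NumberField.RingOfIntegers K) :
    Module.End ℚ (Cycle ψ) :=
  (pushCycle ψ α - ((1 + (Δ : ℚ)) ^ 2) • 1) * (pushCycle ψ β + ((Δ : ℚ) ^ 2) • 1)

/-- `C` is a rational combination of special Lagrangian, and at the same time Cayley, tori. -/
def IsSLCayleyCycle {ψ : Fin 4 → K →+* ℂ} (x : Fin 4 → ℝ) (C : Cycle ψ) : Prop :=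
  ∀ T ∈ C.support, T.IsCalibrated (kahlerMetric x) (slForm x) ∧
    T.IsCalibrated (kahlerMetric x) (cayleyForm x)

/-- `C` is orthogonal to all monomials `dz^μ` except those spanning the space of `M` and `M'`. -/
def PairsOnlyWithM {ψ : Fin 4 → K →+* ℂ} (C : Cycle ψ) : Prop :=
  ∀ μ : Fin 4 → Fin 4 ⊕ Fin 4, Set.range μ ≠ Set.range etaIdx →
    Set.range μ ≠ Set.range etaBarIdx → pairing C (fun _ => monomial μ) = 0

end Torus

/-- `φ₁, …, φ₄` are the embeddings of `F` with `φ_j(x₁) = x_j` and `φ_j(i𝔻) = -(-1)^j i𝔻`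
(indices `1, …, 4`; with indices `0, …, 3` the sign is `(-1)^j`). These conditions determine
them. -/
def IsLabelling (x : Fin 4 → ℝ) (φ : Fin 4 → cmField x →+* ℂ) : Prop :=
  ∀ (j : Fin 4) (y : cmField x),
    ((y : ℂ) = (x 0 : ℂ) → φ j y = (x j : ℂ)) ∧
    ((y : ℂ) = Complex.I * (rootDisc x : ℂ) →
      φ j y = (-1) ^ (j : ℕ) * (Complex.I * (rootDisc x : ℂ)))

end CayleyCycles

end

/-!
The fixed locus `Y` of complex conjugation on `X = ℂ⁴/Λ` is the image of
`{u : ū - u ∈ Λ}`, a finite union of translates of the torus `ℝ⁴/(Λ ∩ ℝ⁴)`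
(`exists_fixed_representatives`, `exists_parametrizes_fixedPoints`). On `ℝ⁴` the form `ω` vanishes,
and `∏ (-1)^j μ_j = 𝔻²` makes `4 Re θ` the volume form of the metric, so that `Y` is special
Lagrangian and Cayley. Multiplication by an integer `α` with all `|φ_j(α)|²` equal to `N` and
`∏ φ_j(α) = N²` scales the metric by `N` and `θ` by `N²`, hence preserves calibrated tori
(`isCalibratedFrame_slForm`). This applies to `i𝔻` and to `1 ± i𝔻`.

On the integral of a monomial `dz^μ` the map `π_α` acts by the product of the conjugates of `α`
attached to the factors of `dz^μ`. For `α = i𝔻` these conjugates are `±i𝔻`. A monomial with a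
repeated coordinate vanishes on `ℝ⁴`; for the others let `p` be the number of plus signs. The
factor `π_b + Δ²` kills the monomials with odd `p`, and `π_a - (1 + Δ)²` those with `p = 2`, since
the product of two conjugates of either sign is `(1 + Δ)²` (`operator_factor_eq_zero`). What remains
are `p = 4` and `p = 0`, the two monomials of `M` and `M'`. The periods there are explicit, and the
matrix of pairings is non-degenerate when `Δ ≠ 1`, which holds because odd permutations in the
Galois group change the sign of `𝔻` (`disc_ne_one`).

For Poincaré duality, translating an affine torus does not change the integral of a closed form, by
Stokes' theorem on a five-dimensional prism (`integral_translate`). Averaging over all translations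
shows that the integral is that of the mean value of the form, which is translation-invariant
(`integral_affine_mul_volume`). Invariant forms are combinations of monomials, so duality has to
be tested only on these (`represents_of_monomial`), and in the end comes down to two linear
equations. Their solution is rational because the covolume of `Λ` is rational and that of `Λ ∩ ℝ⁴`
is a rational multiple of `𝔻`: for the lattices spanned by `ξ^k, βξ^k` and by `ξ^k`, where `ξ = x₁`
and `β = i𝔻`, both are computed from a Vandermonde determinant with value `𝔻`
(`exists_isLatticeBasis`, `exists_realLatticeBasis`).
-/

namespace CayleyCycles

/-! ### Monomials as determinants -/

theorem monomial_apply {k : ℕ} (μ : Fin k → Fin 4 ⊕ Fin 4) (v : Fin k → E) :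
    monomial μ v = (Matrix.of fun i j => coordForm (μ i) (v j)).det := by
  rw [← Matrix.det_transpose, Matrix.det_apply]
  simp [monomial, ContinuousMultilinearMap.alternatization_apply_apply]

theorem coordForm_mul (a : Fin 4 ⊕ Fin 4) (w u : E) :
    coordForm a (w * u) = coordForm a w * coordForm a u := by
  rcases a with j | j <;> simp [coordForm]

/-- Complex multiplication is diagonal on the monomials. -/
theorem monomial_mul {k : ℕ} (μ : Fin k → Fin 4 ⊕ Fin 4) (w : E) (v : Fin k → E) :
    monomial μ (fun i => w * v i) = (∏ i, coordForm (μ i) w) * monomial μ v := by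
  rw [monomial_apply, monomial_apply, ← Matrix.det_mul_column]
  simp [coordForm_mul]

/-- The coordinate to which a coordinate one-form belongs. -/
def formIndex : Fin 4 ⊕ Fin 4 → Fin 4 := Sum.elim id id

/-- The inclusion `ℝ⁴ → ℂ⁴`. -/
def realPt : (Fin 4 → ℝ) →ₗ[ℝ] E where
  toFun r j := (r j : ℂ)
  map_add' r s := by ext j; simp
  map_smul' c r := by ext j; simp

@[simp] theorem realPt_apply (r : Fin 4 → ℝ) (j : Fin 4) : realPt r j = (r j : ℂ) := rfl

theorem coordForm_realPt (a : Fin 4 ⊕ Fin 4) (r : Fin 4 → ℝ) :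
    coordForm a (realPt r) = (r (formIndex a) : ℂ) := by
  rcases a with j | j <;> simp [coordForm, formIndex]

theorem monomial_realPt_eq_zero (μ : Fin 4 → Fin 4 ⊕ Fin 4)
    (hμ : ¬ Function.Injective (formIndex ∘ μ)) (b : Fin 4 → Fin 4 → ℝ) :
    monomial μ (fun i => realPt (b i)) = 0 := by
  rw [monomial_apply]
  simp only [Function.Injective, not_forall] at hμ
  obtain ⟨i, j, hij, hne⟩ := hμ
  refine Matrix.det_zero_of_row_eq hne ?_
  ext k
  simp only [Function.comp_apply] at hij
  simp [coordForm_realPt, hij]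

theorem monomial_realPt (μ : Fin 4 → Fin 4 ⊕ Fin 4) (hμ : ∀ i, formIndex (μ i) = i)
    (b : Fin 4 → Fin 4 → ℝ) :
    monomial μ (fun i => realPt (b i)) = ((Matrix.of b).det : ℂ) := by
  rw [monomial_apply, ← Matrix.det_transpose, ← Complex.ofRealHom_eq_coe, RingHom.map_det]
  congr 1
  ext i j
  simp [coordForm_realPt, hμ]

theorem monomial_comp_perm {k : ℕ} (μ : Fin k → Fin 4 ⊕ Fin 4) (τ : Equiv.Perm (Fin k)) :
    monomial (μ ∘ τ) = ((Equiv.Perm.sign τ : ℤ) : ℂ) • monomial μ := by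
  ext v
  rw [ContinuousAlternatingMap.smul_apply, monomial_apply, monomial_apply, smul_eq_mul,
    ← Matrix.det_permute]
  rfl

theorem exists_perm_of_range_eq {α : Type*} {f g : Fin 4 → α} (hf : Function.Injective f)
    (h : Set.range g = Set.range f) : ∃ τ : Equiv.Perm (Fin 4), g = f ∘ τ := by
  have h1 : ∀ i, ∃ j, f j = g i := fun i => by
    have : g i ∈ Set.range f := h ▸ Set.mem_range_self i
    exact this
  choose t ht using h1
  have hs : Function.Surjective t := fun j => by
    have : f j ∈ Set.range g := h ▸ Set.mem_range_self j
    obtain ⟨i, hi⟩ := this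
    exact ⟨i, hf (by rw [ht, hi])⟩
  refine ⟨Equiv.ofBijective t (Finite.surjective_iff_bijective.mp hs), ?_⟩
  ext i
  simp [ht]

theorem etaIdx_injective : Function.Injective etaIdx := by decide

theorem etaBarIdx_injective : Function.Injective etaBarIdx := by decide

theorem formIndex_etaIdx (i : Fin 4) : formIndex (etaIdx i) = i := by
  fin_cases i <;> rfl

theorem formIndex_etaBarIdx (i : Fin 4) : formIndex (etaBarIdx i) = i := by
  fin_cases i <;> rfl

/-! ### Expansion of four-forms in monomials -/

/-- The coefficients of the real coordinates `x_j, y_j` in the coordinate one-forms: each real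
coordinate is the sum of the coordinate forms with these coefficients. -/
noncomputable def realCoeff : Fin 4 ⊕ Fin 4 → Fin 4 ⊕ Fin 4 → ℂ
  | .inl j, .inl k => if j = k then 1 / 2 else 0
  | .inl j, .inr k => if j = k then 1 / 2 else 0
  | .inr j, .inl k => if j = k then -Complex.I / 2 else 0
  | .inr j, .inr k => if j = k then Complex.I / 2 else 0

/-- The real coordinate dual to a vector of the standard frame. -/
def realCoord : Fin 4 ⊕ Fin 4 → E → ℝ
  | .inl j, u => (u j).re
  | .inr j, u => (u j).im

theorem realCoord_eq_sum (a : Fin 4 ⊕ Fin 4) (u : E) :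
    (realCoord a u : ℂ) = ∑ b, realCoeff a b * coordForm b u := by
  rcases a with j | j
  · simp [realCoord, realCoeff, coordForm, Complex.re_eq_add_conj]
    ring
  · simp [realCoord, realCoeff, coordForm, Complex.im_eq_sub_conj]
    field_simp
    simp
    ring

theorem eq_sum_stdFrame (u : E) : u = ∑ a, realCoord a u • stdFrame a := by
  ext j
  simp only [Fintype.sum_sum_type, stdFrame, realCoord, Finset.sum_apply,
    Pi.smul_apply]
  rw [Finset.sum_eq_single j, Finset.sum_eq_single j]
  · simp
  · intro k _ hk; simp [hk.symm]
  · simp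
  · intro k _ hk; simp [hk.symm]
  · simp

/-- The coefficient of a form at a monomial, as a linear combination of its values on the
standard frame. All multi-indices are used, so that each unordered one is counted `k!` times. -/
noncomputable def formCoeff {k : ℕ} (μ : Fin k → Fin 4 ⊕ Fin 4) (A : E [⋀^Fin k]→L[ℝ] ℂ) : ℂ :=
  (k.factorial : ℂ)⁻¹ *
    ∑ ν : Fin k → Fin 4 ⊕ Fin 4, (∏ i, realCoeff (ν i) (μ i)) * A (fun i => stdFrame (ν i))

theorem apply_eq_sum_prod {k : ℕ} (A : E [⋀^Fin k]→L[ℝ] ℂ) (v : Fin k → E) :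
    A v = ∑ μ : Fin k → Fin 4 ⊕ Fin 4,
      k.factorial * formCoeff μ A * ∏ i, coordForm (μ i) (v i) := by
  have h1 : A v = ∑ ν : Fin k → Fin 4 ⊕ Fin 4,
      (∏ i, (realCoord (ν i) (v i) : ℂ)) * A (fun i => stdFrame (ν i)) := by
    have h := A.toMultilinearMap.map_sum (g := fun i a => realCoord a (v i) • stdFrame a)
    simp only [← eq_sum_stdFrame] at h
    refine (h.trans ?_)
    refine Finset.sum_congr rfl fun ν _ => ?_
    rw [MultilinearMap.map_smul_univ]
    simp
  rw [h1]
  have h2 : ∀ ν : Fin k → Fin 4 ⊕ Fin 4, (∏ i, (realCoord (ν i) (v i) : ℂ)) =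
      ∑ μ : Fin k → Fin 4 ⊕ Fin 4,
        (∏ i, realCoeff (ν i) (μ i)) * ∏ i, coordForm (μ i) (v i) := fun ν => by
    simp only [realCoord_eq_sum, Finset.prod_univ_sum, Finset.prod_mul_distrib,
      Fintype.piFinset_univ]
  have hk : (k.factorial : ℂ) ≠ 0 := by exact_mod_cast k.factorial_ne_zero
  simp only [h2, Finset.sum_mul]
  rw [Finset.sum_comm]
  refine Finset.sum_congr rfl fun μ _ => ?_
  simp only [formCoeff, Finset.sum_mul, mul_inv_cancel_left₀ hk]
  refine Finset.sum_congr rfl fun ν _ => ?_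
  ring

/-- Every translation-invariant form is a combination of monomials. -/
theorem eq_sum_monomial {k : ℕ} (A : E [⋀^Fin k]→L[ℝ] ℂ) (v : Fin k → E) :
    A v = ∑ μ : Fin k → Fin 4 ⊕ Fin 4, formCoeff μ A * monomial μ v := by
  have hk : (k.factorial : ℂ) ≠ 0 := by exact_mod_cast k.factorial_ne_zero
  -- `A` is alternating, so it is `1/k!` times its own alternatization
  have h1 : (k.factorial : ℂ) * A v =
      ∑ σ : Equiv.Perm (Fin k), Equiv.Perm.sign σ • A (v ∘ σ) := by
    have : ∀ σ : Equiv.Perm (Fin k), Equiv.Perm.sign σ • A (v ∘ σ) = A v := fun σ => by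
      have := A.toAlternatingMap.map_perm v σ
      simp only [ContinuousAlternatingMap.coe_toAlternatingMap] at this
      rw [this, smul_smul, Int.units_mul_self, one_smul]
    simp only [this, Finset.sum_const, Finset.card_univ, Fintype.card_perm, Fintype.card_fin,
      nsmul_eq_mul]
  refine mul_left_cancel₀ hk ?_
  rw [h1]
  simp only [monomial, ContinuousMultilinearMap.alternatization_apply_apply]
  simp_rw [apply_eq_sum_prod A (v ∘ _), Finset.smul_sum, Finset.mul_sum]
  rw [Finset.sum_comm]
  refine Finset.sum_congr rfl fun μ _ => Finset.sum_congr rfl fun σ _ => ?_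
  simp only [ContinuousMultilinearMap.compContinuousLinearMap_apply,
    ContinuousMultilinearMap.mkPiAlgebra_apply, Function.comp_apply, Units.smul_def,
    zsmul_eq_mul]
  ring

/-! ### Wedge products -/

theorem wedge_apply {m n : ℕ} (α : E [⋀^Fin m]→L[ℝ] ℂ) (β : E [⋀^Fin n]→L[ℝ] ℂ)
    (w : Fin m ⊕ Fin n → E) :
    wedge α β w = ((m.factorial * n.factorial : ℕ) : ℂ)⁻¹ *
      ∑ σ : Equiv.Perm (Fin m ⊕ Fin n), Equiv.Perm.sign σ •
        (α (fun i => w (σ (.inl i))) * β (fun i => w (σ (.inr i)))) := by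
  have h := congrArg (fun A => LinearMap.mul' ℝ ℂ (A w))
    (MultilinearMap.domCoprod_alternization_eq α.toAlternatingMap β.toAlternatingMap)
  have hk : ((m.factorial * n.factorial : ℕ) : ℂ) ≠ 0 := by
    exact_mod_cast mul_ne_zero m.factorial_ne_zero n.factorial_ne_zero
  rw [eq_inv_mul_iff_mul_eq₀ hk, wedge, LinearMap.compAlternatingMap_apply]
  simp only [Fintype.card_fin, AlternatingMap.smul_apply, map_nsmul] at h
  rw [nsmul_eq_mul] at h
  rw [← h, MultilinearMap.alternatization_apply, map_sum]
  refine Finset.sum_congr rfl fun σ _ => ?_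
  simp only [Units.smul_def, map_zsmul]
  rfl

theorem wedge_add_left {m n : ℕ} (α α' : E [⋀^Fin m]→L[ℝ] ℂ) (β : E [⋀^Fin n]→L[ℝ] ℂ)
    (w : Fin m ⊕ Fin n → E) : wedge (α + α') β w = wedge α β w + wedge α' β w := by
  simp only [wedge_apply, ContinuousAlternatingMap.add_apply, add_mul, smul_add,
    Finset.sum_add_distrib, mul_add]

theorem wedge_smul_left {m n : ℕ} (c : ℂ) (α : E [⋀^Fin m]→L[ℝ] ℂ) (β : E [⋀^Fin n]→L[ℝ] ℂ)
    (w : Fin m ⊕ Fin n → E) : wedge (c • α) β w = c * wedge α β w := by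
  simp only [wedge_apply, ContinuousAlternatingMap.smul_apply, smul_eq_mul, Finset.mul_sum,
    Units.smul_def, zsmul_eq_mul]
  refine Finset.sum_congr rfl fun σ _ => ?_
  ring

theorem wedge_smul_right {m n : ℕ} (c : ℂ) (α : E [⋀^Fin m]→L[ℝ] ℂ) (β : E [⋀^Fin n]→L[ℝ] ℂ)
    (w : Fin m ⊕ Fin n → E) : wedge α (c • β) w = c * wedge α β w := by
  simp only [wedge_apply, ContinuousAlternatingMap.smul_apply, smul_eq_mul, Finset.mul_sum,
    Units.smul_def, zsmul_eq_mul]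
  refine Finset.sum_congr rfl fun σ _ => ?_
  ring

theorem wedge_eq_sum_monomial {m n : ℕ} (α : E [⋀^Fin m]→L[ℝ] ℂ) (A : E [⋀^Fin n]→L[ℝ] ℂ)
    (w : Fin m ⊕ Fin n → E) :
    wedge α A w = ∑ μ : Fin n → Fin 4 ⊕ Fin 4, formCoeff μ A * wedge α (monomial μ) w := by
  simp only [wedge_apply]
  simp_rw [eq_sum_monomial A, Finset.mul_sum]
  rw [Finset.sum_comm' (t' := Finset.univ) (s' := fun _ => Finset.univ) (by simp)]
  refine Finset.sum_congr rfl fun σ _ => ?_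
  rw [Finset.smul_sum, Finset.mul_sum]
  refine Finset.sum_congr rfl fun μ _ => ?_
  simp only [Units.smul_def, zsmul_eq_mul]
  ring

theorem wedge_monomial {m n : ℕ} (μ : Fin m → Fin 4 ⊕ Fin 4) (ν : Fin n → Fin 4 ⊕ Fin 4)
    (w : Fin m ⊕ Fin n → E) :
    wedge (monomial μ) (monomial ν) w =
      (Matrix.of fun a b => coordForm (Sum.elim μ ν a) (w b)).det := by
  have h : ∀ {k : ℕ} (κ : Fin k → Fin 4 ⊕ Fin 4), (monomial κ).toAlternatingMap =
      MultilinearMap.alternatization ((MultilinearMap.mkPiAlgebra ℝ (Fin k) ℂ).compLinearMap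
        (fun i => (coordForm (κ i) : E →ₗ[ℝ] ℂ))) := fun κ => by
    ext v
    simp [monomial, MultilinearMap.alternatization_apply]
  rw [wedge, h, h, ← MultilinearMap.domCoprod_alternization, ← Matrix.det_transpose,
    Matrix.det_apply]
  simp [MultilinearMap.alternatization_apply, LinearMap.compAlternatingMap_apply]

/-- A product of two monomials of degree four vanishes unless their factors are complementary. -/
theorem wedge_monomial_eq_zero (μ ν : Fin 4 → Fin 4 ⊕ Fin 4)
    (h : ¬ Function.Injective (Sum.elim μ ν)) (w : Fin 4 ⊕ Fin 4 → E) :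
    wedge (monomial μ) (monomial ν) w = 0 := by
  rw [wedge_monomial]
  simp only [Function.Injective, not_forall] at h
  obtain ⟨i, j, hij, hne⟩ := h
  refine Matrix.det_zero_of_row_eq hne ?_
  ext k
  simp [hij]

theorem range_eq_of_injective_elim {μ ν ν' : Fin 4 → Fin 4 ⊕ Fin 4}
    (h : Function.Injective (Sum.elim μ ν)) (h' : Function.Injective (Sum.elim μ ν')) :
    Set.range ν = Set.range ν' := by
  have key : ∀ {κ : Fin 4 → Fin 4 ⊕ Fin 4}, Function.Injective (Sum.elim μ κ) →
      Set.range κ = (Set.range μ)ᶜ := fun {κ} hκ => by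
    have hs := (Finite.injective_iff_surjective.mp hκ)
    ext a
    constructor
    · rintro ⟨i, rfl⟩ ⟨j, hj⟩
      have := @hκ (.inl j) (.inr i) (by simpa using hj)
      simp at this
    · intro ha
      obtain ⟨b | b, hb⟩ := hs a
      · exact absurd ⟨b, by simpa using hb⟩ ha
      · exact ⟨b, by simpa using hb⟩
  rw [key h, key h']

theorem wedge_eta_etaBar : wedge (monomial etaIdx) (monomial etaBarIdx) stdFrame = 16 := by
  rw [wedge_monomial]
  have : (Matrix.of fun a b => coordForm (Sum.elim etaIdx etaBarIdx a) (stdFrame b)) =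
      Matrix.fromBlocks (1 : Matrix (Fin 4) (Fin 4) ℂ)
        (Matrix.diagonal ![Complex.I, -Complex.I, Complex.I, -Complex.I]) 1
        (Matrix.diagonal ![-Complex.I, Complex.I, -Complex.I, Complex.I]) := by
    ext a b
    rcases a with a | a <;> rcases b with b | b <;> fin_cases a <;> fin_cases b <;>
      simp [etaIdx, etaBarIdx, coordForm, stdFrame]
  rw [this, Matrix.det_fromBlocks_one₁₁, Matrix.one_mul, Matrix.diagonal_sub, Matrix.det_diagonal]
  simp [Fin.prod_univ_four]
  ring_nf
  simp [Complex.I_pow_four]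

theorem wedge_etaBar_eta : wedge (monomial etaBarIdx) (monomial etaIdx) stdFrame = 16 := by
  rw [wedge_monomial]
  have : (Matrix.of fun a b => coordForm (Sum.elim etaBarIdx etaIdx a) (stdFrame b)) =
      Matrix.fromBlocks (1 : Matrix (Fin 4) (Fin 4) ℂ)
        (Matrix.diagonal ![-Complex.I, Complex.I, -Complex.I, Complex.I]) 1
        (Matrix.diagonal ![Complex.I, -Complex.I, Complex.I, -Complex.I]) := by
    ext a b
    rcases a with a | a <;> rcases b with b | b <;> fin_cases a <;> fin_cases b <;>
      simp [etaIdx, etaBarIdx, coordForm, stdFrame]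
  rw [this, Matrix.det_fromBlocks_one₁₁, Matrix.one_mul, Matrix.diagonal_sub, Matrix.det_diagonal]
  simp [Fin.prod_univ_four]
  ring_nf
  simp [Complex.I_pow_four]

/-! ### Calibrated frames -/

theorem rootDisc_pos {x : Fin 4 → ℝ} (hx : StrictAnti x) : 0 < rootDisc x := by
  have h : ∀ i j : Fin 4, i < j → 0 < x i - x j := fun i j hij => sub_pos.mpr (hx hij)
  have h01 := h 0 1 (by decide)
  have h02 := h 0 2 (by decide)
  have h03 := h 0 3 (by decide)
  have h12 := h 1 2 (by decide)
  have h13 := h 1 3 (by decide)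
  have h23 := h 2 3 (by decide)
  unfold rootDisc
  positivity

/-- The coefficients `(𝔻/Δ) (-1)^j μ_j` of `ω`. -/
noncomputable def omegaCoeff (x : Fin 4 → ℝ) (j : Fin 4) : ℝ :=
  rootDisc x / rootDisc x ^ 2 * ((-1) ^ (j : ℕ) * muCoeff x j)

theorem prod_omegaCoeff {x : Fin 4 → ℝ} (hx : StrictAnti x) :
    ∏ j, omegaCoeff x j = 1 / rootDisc x ^ 2 := by
  have hD := (rootDisc_pos hx).ne'
  have hμ : ∏ j : Fin 4, ((-1) ^ (j : ℕ) * muCoeff x j) = rootDisc x ^ 2 := by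
    have h0 : Finset.univ.erase (0 : Fin 4) = {1, 2, 3} := by decide
    have h1 : Finset.univ.erase (1 : Fin 4) = {0, 2, 3} := by decide
    have h2 : Finset.univ.erase (2 : Fin 4) = {0, 1, 3} := by decide
    have h3 : Finset.univ.erase (3 : Fin 4) = {0, 1, 2} := by decide
    simp [Fin.prod_univ_four, muCoeff, h0, h1, h2, h3, rootDisc]
    ring
  simp only [omegaCoeff, Finset.prod_mul_distrib] at hμ ⊢
  rw [hμ]
  simp
  field_simp

theorem omegaForm_apply (x : Fin 4 → ℝ) (v : Fin 2 → E) :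
    omegaForm x v = ∑ j, Complex.I * omegaCoeff x j *
      (v 0 j * (starRingEnd ℂ) (v 1 j) - v 1 j * (starRingEnd ℂ) (v 0 j)) := by
  simp only [omegaForm, ContinuousAlternatingMap.sum_apply, ContinuousAlternatingMap.smul_apply,
    smul_eq_mul, monomial_apply, Matrix.det_fin_two]
  refine Finset.sum_congr rfl fun j _ => ?_
  simp [omegaCoeff, coordForm]

theorem kahlerMetric_apply (x : Fin 4 → ℝ) (u v : E) :
    kahlerMetric x u v = ∑ j, 2 * omegaCoeff x j * (u j * (starRingEnd ℂ) (v j)).re := by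
  simp only [kahlerMetric, omegaForm_apply, Complex.re_sum]
  refine Finset.sum_congr rfl fun j _ => ?_
  simp
  ring

/-- `w ℝ⁴` is Lagrangian for every `w ∈ ℂ⁴`. -/
theorem omegaForm_mul_realPt (x : Fin 4 → ℝ) (w : E) (b : Fin 2 → Fin 4 → ℝ) :
    omegaForm x (fun i => w * realPt (b i)) = 0 := by
  rw [omegaForm_apply]
  refine Finset.sum_eq_zero fun j _ => ?_
  simp
  right
  ring

theorem cayleyForm_mul_realPt (x : Fin 4 → ℝ) (w : E) (b : Fin 4 → Fin 4 → ℝ) :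
    cayleyForm x (fun i => w * realPt (b i)) = slForm x (fun i => w * realPt (b i)) := by
  have h : wedge (omegaForm x) (omegaForm x)
      (fun i => w * realPt (b (finSumFinEquiv i))) = 0 := by
    rw [wedge_apply, Finset.sum_eq_zero, mul_zero]
    intro σ _
    rw [omegaForm_mul_realPt x w fun i => b (finSumFinEquiv (σ (.inl i))), zero_mul, smul_zero]
  simp only [cayleyForm, AlternatingMap.add_apply, LinearMap.compAlternatingMap_apply,
    AlternatingMap.smul_apply, AlternatingMap.domDomCongr_apply, Function.comp_def]
  erw [h]
  simp

theorem slForm_mul_realPt (x : Fin 4 → ℝ) (w : E) (b : Fin 4 → Fin 4 → ℝ) :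
    slForm x (fun i => w * realPt (b i)) =
      4 / rootDisc x * (Matrix.of b).det * (∏ j, w j).re := by
  simp only [slForm, LinearMap.compAlternatingMap_apply, AlternatingMap.smul_apply,
    ContinuousAlternatingMap.coe_toAlternatingMap, thetaForm, ContinuousAlternatingMap.smul_apply]
  rw [monomial_mul, monomial_realPt _ (fun _ => rfl)]
  have h : ∏ i : Fin 4, coordForm (.inl i) w = ∏ j, w j := by simp [coordForm]
  rw [h]
  simp
  ring

theorem linearIndependent_mul_realPt {w : E} (hw : ∀ j, w j ≠ 0) {b : Fin 4 → Fin 4 → ℝ}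
    (hb : (Matrix.of b).det ≠ 0) : LinearIndependent ℝ fun i => w * realPt (b i) := by
  have hb' : LinearIndependent ℝ b :=
    Matrix.linearIndependent_rows_of_det_ne_zero (A := Matrix.of b) hb
  refine hb'.map' ((LinearMap.mulLeft ℝ w).comp realPt) (LinearMap.ker_eq_bot'.mpr ?_)
  intro r hr
  ext j
  have := congrFun hr j
  simpa [hw j] using this

/-- Multiplication by `w` carries positively oriented frames of `ℝ⁴` to special Lagrangian frames
when all `|w_j|²` are equal to the same `N` and `w₁w₂w₃w₄ = N²`. -/
theorem isCalibratedFrame_slForm {x : Fin 4 → ℝ} (hx : StrictAnti x) {w : E} {N : ℝ} (hN : 0 < N)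
    (hw : ∀ j, w j * (starRingEnd ℂ) (w j) = N) (hprod : ∏ j, w j = (N : ℂ) ^ 2)
    {b : Fin 4 → Fin 4 → ℝ} (hb : 0 < (Matrix.of b).det) :
    IsCalibratedFrame (kahlerMetric x) (slForm x) fun i => w * realPt (b i) := by
  have hD := rootDisc_pos hx
  refine ⟨linearIndependent_mul_realPt (fun j hj => ?_) hb.ne', ?_⟩
  · have := hw j
    rw [hj, zero_mul] at this
    exact hN.ne (by exact_mod_cast this)
  have hg : (Matrix.of fun i k => kahlerMetric x (w * realPt (b i)) (w * realPt (b k))) =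
      Matrix.of b * Matrix.diagonal (fun j => 2 * omegaCoeff x j * N) * (Matrix.of b).transpose := by
    ext i k
    rw [Matrix.mul_apply]
    simp only [Matrix.of_apply, kahlerMetric_apply, Matrix.mul_diagonal, Matrix.transpose_apply]
    refine Finset.sum_congr rfl fun j _ => ?_
    have : (w * realPt (b i)) j * (starRingEnd ℂ) ((w * realPt (b k)) j) =
        ((N * (b i j * b k j) : ℝ) : ℂ) := by
      push_cast
      rw [← hw j]
      simp
      ring
    rw [this, Complex.ofReal_re]
    ring
  rw [hg, Matrix.det_mul, Matrix.det_mul, Matrix.det_transpose, Matrix.det_diagonal,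
    slForm_mul_realPt, hprod]
  have hp : ∏ j, 2 * omegaCoeff x j * N = 16 * N ^ 4 / rootDisc x ^ 2 := by
    simp only [Finset.prod_mul_distrib, prod_omegaCoeff hx]
    simp
    ring
  rw [hp, eq_comm, Real.sqrt_eq_iff_mul_self_eq_of_pos]
  · rw [show ((N : ℂ) ^ 2).re = N ^ 2 by norm_cast]
    field_simp
    ring
  · rw [show ((N : ℂ) ^ 2).re = N ^ 2 by norm_cast]
    positivity

theorem isCalibratedFrame_cayleyForm {x : Fin 4 → ℝ} (hx : StrictAnti x) {w : E} {N : ℝ}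
    (hN : 0 < N) (hw : ∀ j, w j * (starRingEnd ℂ) (w j) = N) (hprod : ∏ j, w j = (N : ℂ) ^ 2)
    {b : Fin 4 → Fin 4 → ℝ} (hb : 0 < (Matrix.of b).det) :
    IsCalibratedFrame (kahlerMetric x) (cayleyForm x) fun i => w * realPt (b i) := by
  obtain ⟨h1, h2⟩ := isCalibratedFrame_slForm hx hN hw hprod hb
  exact ⟨h1, by rw [cayleyForm_mul_realPt, h2]⟩

/-! ### Integrals over affine tori -/

section Torus

variable {K : Type} [Field K] {ψ : Fin 4 → K →+* ℂ}

theorem contDiff_form_apply {ξ : E → E [⋀^Fin 4]→L[ℝ] ℂ} (hξ : IsClosedForm ψ ξ)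
    (v : Fin 4 → E) : ContDiff ℝ ∞ fun u => ξ u v :=
  (ContinuousAlternatingMap.apply ℝ E ℂ v).contDiff.comp hξ.smooth

/-- The linear map `ℝⁿ → ℂ⁴` with the given columns. -/
noncomputable def frameMap {n : ℕ} (v : Fin n → E) : (Fin n → ℝ) →L[ℝ] E :=
  LinearMap.toContinuousLinearMap (Fintype.linearCombination ℝ v)

theorem frameMap_apply {n : ℕ} (v : Fin n → E) (t : Fin n → ℝ) :
    frameMap v t = ∑ i, t i • v i := rfl

theorem frameMap_single {n : ℕ} (v : Fin n → E) (i : Fin n) :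
    frameMap v (Pi.single i 1) = v i := by
  simp [frameMap, Fintype.linearCombination_apply_single]

theorem frameMap_insertNth {n : ℕ} (V : Fin (n + 1) → E) (i : Fin (n + 1)) (a : ℝ)
    (t : Fin n → ℝ) :
    frameMap V (i.insertNth (α := fun _ => ℝ) a t) = a • V i + frameMap (i.removeNth V) t := by
  rw [frameMap_apply, Fin.sum_univ_succAbove _ i]
  simp [frameMap_apply, Fin.removeNth]

/-- The integral of a closed form over an affine torus does not change when the torus is
translated. This is Stokes' theorem on the prism `[0, 1]⁵` swept out by the translation, whose
lateral faces cancel in pairs. -/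
theorem integral_translate {ξ : E → E [⋀^Fin 4]→L[ℝ] ℂ} (hξ : IsClosedForm ψ ξ) (p u : E)
    (v : Fin 4 → E) (hv : ∀ i, v i ∈ lattice ψ) :
    ∫ t in Set.Icc (0 : Fin 4 → ℝ) 1, ξ (p + frameMap v t + u) v =
      ∫ t in Set.Icc (0 : Fin 4 → ℝ) 1, ξ (p + frameMap v t) v := by
  set V : Fin 5 → E := Fin.cons u v with hV
  have hVs : ∀ i : Fin 4, V i.succ = v i := fun i => by simp [hV]
  have hV0 : (0 : Fin 5).removeNth V = v := by
    ext i j; simp [Fin.removeNth, hVs]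
  let f : Fin 5 → (Fin 5 → ℝ) → ℂ := fun i y =>
    (-1) ^ (i : ℕ) * ξ (p + frameMap V y) (i.removeNth V)
  let f' : Fin 5 → (Fin 5 → ℝ) → (Fin 5 → ℝ) →L[ℝ] ℂ := fun i y =>
    ((-1) ^ (i : ℕ) : ℂ) •
      (fderiv ℝ (fun x => ξ x (i.removeNth V)) (p + frameMap V y)).comp (frameMap V)
  have hderiv : ∀ i y, HasFDerivAt (f i) (f' i y) y := fun i y => by
    have h1 : HasFDerivAt (fun x => ξ x (i.removeNth V))
        (fderiv ℝ (fun x => ξ x (i.removeNth V)) (p + frameMap V y)) (p + frameMap V y) :=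
      ((contDiff_form_apply hξ _).differentiable (by simp)).differentiableAt.hasFDerivAt
    exact (h1.comp y ((frameMap V).hasFDerivAt.const_add p)).const_smul ((-1) ^ (i : ℕ) : ℂ)
  have hdiv : ∀ y, ∑ i, f' i y (Pi.single i 1) = 0 := fun y => by
    have := congrArg (fun A => A V) (hξ.closed (p + frameMap V y))
    rw [extDeriv_apply ((hξ.smooth.differentiable (by simp)).differentiableAt)] at this
    simpa [f', frameMap_single] using this
  have key := MeasureTheory.integral_divergence_of_hasFDerivAt_off_countable' (0 : Fin 5 → ℝ) 1
    zero_le_one f f' ∅ Set.countable_empty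
    (fun i => (Continuous.continuousOn (continuous_iff_continuousAt.mpr
      fun y => (hderiv i y).continuousAt)))
    (fun y _ i => hderiv i y)
    (by simp only [hdiv]; exact MeasureTheory.integrableOn_zero)
  simp only [hdiv, MeasureTheory.integral_zero] at key
  rw [Fin.sum_univ_succ, Finset.sum_eq_zero (s := Finset.univ)] at key
  · rw [add_zero, eq_comm, sub_eq_zero] at key
    convert! key using 3 with t t
    · simp only [f]
      erw [frameMap_insertNth, hV0]
      simp only [Fin.val_zero, pow_zero, one_mul, Pi.one_apply, one_smul, hV, Fin.cons_zero]
      congr 2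
      abel
    · simp only [f]
      erw [frameMap_insertNth, hV0]
      simp
  · intro i _
    rw [sub_eq_zero]
    congr 1
    ext t
    simp only [f]
    erw [frameMap_insertNth, frameMap_insertNth]
    simp only [Pi.one_apply, one_smul, Pi.zero_apply, zero_smul, zero_add]
    rw [← hξ.periodic (p + frameMap (i.succ.removeNth V) t) (V i.succ) (hVs i ▸ hv i)]
    congr 3
    abel

/-- A lattice basis, i.e. a real basis of `ℂ⁴` that generates `Λ`. -/
def IsLatticeBasis (ψ : Fin 4 → K →+* ℂ) (B : Module.Basis (Fin 8) ℝ E) : Prop :=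
  (Submodule.span ℤ (Set.range B)).toAddSubgroup = lattice ψ

open MeasureTheory in
theorem integral_fundamentalDomain_add {B : Module.Basis (Fin 8) ℝ E} (hB : IsLatticeBasis ψ B)
    {f : E → ℂ} (hf : ∀ u, ∀ l ∈ lattice ψ, f (u + l) = f u) (c : E) :
    ∫ u in ZSpan.fundamentalDomain B, f (c + u) = ∫ u in ZSpan.fundamentalDomain B, f u := by
  have hFD := ZSpan.isAddFundamentalDomain B (volume : Measure E)
  have hinv : ∀ (g : Submodule.span ℤ (Set.range B)) (u : E), f (g +ᵥ u) = f u := fun g u => by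
    have hg : (g : E) ∈ lattice ψ := by
      rw [← hB]; exact g.2
    rw [← hf u g hg, add_comm]
    rfl
  have : VAddInvariantMeasure (Submodule.span ℤ (Set.range B)) E volume :=
    inferInstanceAs (VAddInvariantMeasure (Submodule.span ℤ (Set.range B)).toAddSubgroup E volume)
  have h := (hFD.vadd_of_comm c).setIntegral_eq hFD hinv
  rw [← h]
  have h2 := (measurePreserving_add_left (volume : Measure E) c).setIntegral_image_emb
    (measurableEmbedding_addLeft c) f (ZSpan.fundamentalDomain B)
  rw [← h2]
  rfl

open MeasureTheory in
/-- The integral of a closed form over an affine torus is the value on its frame of the average of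
the form over `X`. -/
theorem integral_affine_mul_volume {B : Module.Basis (Fin 8) ℝ E} (hB : IsLatticeBasis ψ B)
    {ξ : E → E [⋀^Fin 4]→L[ℝ] ℂ} (hξ : IsClosedForm ψ ξ) (p : E)
    (v : Fin 4 → E) (hv : ∀ i, v i ∈ lattice ψ) :
    (volume.real (ZSpan.fundamentalDomain B) : ℂ) *
        ∫ t in Set.Icc (0 : Fin 4 → ℝ) 1, ξ (p + frameMap v t) v =
      ∫ u in ZSpan.fundamentalDomain B, ξ u v := by
  have hc := (contDiff_form_apply hξ v).continuous
  have h1 : ∫ u in ZSpan.fundamentalDomain B, ∫ t in Set.Icc (0 : Fin 4 → ℝ) 1,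
      ξ (p + frameMap v t + u) v = (volume.real (ZSpan.fundamentalDomain B) : ℂ) *
        ∫ t in Set.Icc (0 : Fin 4 → ℝ) 1, ξ (p + frameMap v t) v := by
    simp only [integral_translate hξ p _ v hv]
    rw [setIntegral_const]
    simp
  rw [← h1, integral_integral_swap]
  · simp only [integral_fundamentalDomain_add hB (f := fun u => ξ u v)
      (fun u l hl => by rw [hξ.periodic u l hl])]
    rw [setIntegral_const]
    simp [measureReal_def, Real.volume_Icc_pi]
  · rw [Measure.prod_restrict]
    have hcomp : IsCompact (closure (ZSpan.fundamentalDomain B) ×ˢ Set.Icc (0 : Fin 4 → ℝ) 1) :=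
      (ZSpan.fundamentalDomain_isBounded B).isCompact_closure.prod isCompact_Icc
    refine IntegrableOn.mono_set ?_ (Set.prod_mono subset_closure subset_rfl)
    refine ContinuousOn.integrableOn_compact hcomp (Continuous.continuousOn ?_)
    have : Continuous fun z : E × (Fin 4 → ℝ) => p + frameMap v z.2 + z.1 := by fun_prop
    exact hc.comp this

end Torus

/-! ### The lattice of the ring of integers -/

/-- The standard real basis `(e_j, i e_j)` of `ℂ⁴`. -/
noncomputable def stdBasisE : Module.Basis (Fin 4 ⊕ Fin 4) ℝ E :=
  Module.Basis.ofEquivFun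
    { toFun := fun u a => realCoord a u
      map_add' := fun u v => by ext a; rcases a with j | j <;> simp [realCoord]
      map_smul' := fun c u => by ext a; rcases a with j | j <;> simp [realCoord]
      invFun := fun r j => ⟨r (.inl j), r (.inr j)⟩
      left_inv := fun u => by ext j; simp [realCoord]
      right_inv := fun r => by ext a; rcases a with j | j <;> simp [realCoord] }

theorem stdBasisE_repr (u : E) (a : Fin 4 ⊕ Fin 4) : stdBasisE.repr u a = realCoord a u := rfl

open MeasureTheory in
theorem volume_fundamentalDomain_stdBasisE :
    volume (ZSpan.fundamentalDomain stdBasisE) = 1 := by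
  have h : ZSpan.fundamentalDomain stdBasisE = Set.univ.pi fun _ : Fin 4 =>
      Complex.measurableEquivPi ⁻¹' (Set.univ.pi fun _ => Set.Ico 0 1) := by
    ext u
    simp [ZSpan.mem_fundamentalDomain, stdBasisE_repr, realCoord, Fin.forall_fin_two, forall_and]
  rw [h, volume_pi, Measure.pi_pi, Complex.volume_preserving_equiv_pi.measure_preimage, volume_pi,
    Measure.pi_pi]
  · simp
  · exact (MeasurableSet.pi Set.countable_univ fun _ _ => measurableSet_Ico).nullMeasurableSet

theorem det_vandermonde_eq_rootDisc (x : Fin 4 → ℝ) : (Matrix.vandermonde x).det = rootDisc x := by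
  rw [Matrix.det_vandermonde]
  have h0 : Finset.Ioi (0 : Fin 4) = {1, 2, 3} := by decide
  have h1 : Finset.Ioi (1 : Fin 4) = {2, 3} := by decide
  have h2 : Finset.Ioi (2 : Fin 4) = {3} := by decide
  have h3 : Finset.Ioi (3 : Fin 4) = ∅ := by decide
  simp [Fin.prod_univ_four, h0, h1, h2, h3, rootDisc]
  ring

section Lattice

variable {K : Type} [Field K]

/-- The elements `ξ` and `β` of `K` have the conjugates `x_j` and `±i𝔻` required of `x₁` and `i𝔻`,
and the degree of `K` is at most eight, so that it is generated by these. -/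
structure IsCMGenerators [NumberField K] (φ : Fin 4 → K →+* ℂ) (x : Fin 4 → ℝ) (ξ β : K) :
    Prop where
  anti : StrictAnti x
  map_root : ∀ j, φ j ξ = x j
  map_disc : ∀ j, φ j β = (-1) ^ (j : ℕ) * (Complex.I * rootDisc x)
  finrank_le : Module.finrank ℚ K ≤ 8

/-- The elements `ξ^k` and `β ξ^k`, for `k < 4`. -/
def powFrame (ξ β : K) : Fin 4 ⊕ Fin 4 → K :=
  Sum.elim (fun k => ξ ^ (k : ℕ)) (fun k => β * ξ ^ (k : ℕ))

/-- The map `y ↦ (φ₁(y), …, φ₄(y))` is `ℚ`-linear. -/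
noncomputable def coordsLinear [CharZero K] (φ : Fin 4 → K →+* ℂ) : K →ₗ[ℚ] E where
  toFun := coords φ
  map_add' y z := by ext j; simp [coords]
  map_smul' q y := by ext j; simp [coords, Algebra.smul_def]

theorem coordsLinear_apply [CharZero K] (φ : Fin 4 → K →+* ℂ) (y : K) :
    coordsLinear φ y = coords φ y := rfl

theorem coords_mem_lattice (φ : Fin 4 → K →+* ℂ) (y : NumberField.RingOfIntegers K) :
    coords φ (y : K) ∈ lattice φ := ⟨y, rfl⟩

variable [NumberField K] {φ : Fin 4 → K →+* ℂ} {x : Fin 4 → ℝ} {ξ β : K}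

namespace IsCMGenerators

theorem coords_powFrame_inl (h : IsCMGenerators φ x ξ β) (j k : Fin 4) :
    coords φ (powFrame ξ β (.inl k)) j = ((x j ^ (k : ℕ) : ℝ) : ℂ) := by
  simp [coords, powFrame, h.map_root]

theorem coords_powFrame_inr (h : IsCMGenerators φ x ξ β) (j k : Fin 4) :
    coords φ (powFrame ξ β (.inr k)) j =
      ((((-1) ^ (j : ℕ) * rootDisc x * x j ^ (k : ℕ) : ℝ)) : ℂ) * Complex.I := by
  simp only [coords, powFrame, Sum.elim_inr, map_mul, map_pow, h.map_root, h.map_disc]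
  push_cast
  ring

theorem realCoord_coords_powFrame (h : IsCMGenerators φ x ξ β) (a k : Fin 4 ⊕ Fin 4) :
    realCoord a (coords φ (powFrame ξ β k)) =
      Matrix.fromBlocks (Matrix.vandermonde x) 0 0
        (Matrix.diagonal (fun j : Fin 4 => (-1) ^ (j : ℕ) * rootDisc x) * Matrix.vandermonde x)
        a k := by
  rcases a with j | j <;> rcases k with k | k <;>
    simp only [realCoord, h.coords_powFrame_inl, h.coords_powFrame_inr, Complex.ofReal_re,
      Complex.ofReal_im, Complex.re_ofReal_mul, Complex.im_ofReal_mul, Complex.I_re, Complex.I_im,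
      Matrix.fromBlocks_apply₁₁, Matrix.fromBlocks_apply₁₂, Matrix.fromBlocks_apply₂₁,
      Matrix.fromBlocks_apply₂₂, Matrix.zero_apply, Matrix.diagonal_mul, Matrix.vandermonde_apply,
      mul_zero, mul_one]

/-- The powers of `ξ` contribute to the real parts and their multiples by `β` to the imaginary parts,
so that the determinant is the product of two Vandermonde determinants and of the conjugates of
`β/i`. -/
theorem det_coords_powFrame (h : IsCMGenerators φ x ξ β) :
    stdBasisE.det (fun k => coords φ (powFrame ξ β k)) = rootDisc x ^ 6 := by
  have hM : stdBasisE.toMatrix (fun k => coords φ (powFrame ξ β k)) =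
      Matrix.fromBlocks (Matrix.vandermonde x) 0 0
        (Matrix.diagonal (fun j : Fin 4 => (-1) ^ (j : ℕ) * rootDisc x) *
          Matrix.vandermonde x) := by
    ext a k
    rw [Module.Basis.toMatrix_apply, stdBasisE_repr, h.realCoord_coords_powFrame]
  rw [Module.Basis.det_apply, hM, Matrix.det_fromBlocks_zero₂₁, Matrix.det_mul,
    Matrix.det_diagonal, det_vandermonde_eq_rootDisc]
  simp [Fin.prod_univ_four]
  ring

theorem linearIndependent_coords_powFrame (h : IsCMGenerators φ x ξ β) :
    LinearIndependent ℝ fun k => coords φ (powFrame ξ β k) := by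
  have hu : IsUnit (stdBasisE.det (fun k => coords φ (powFrame ξ β k))) := by
    rw [h.det_coords_powFrame]
    exact (pow_ne_zero _ (rootDisc_pos h.anti).ne').isUnit
  exact ((Module.Basis.is_basis_iff_det stdBasisE).mpr hu).1

theorem linearIndependent_powFrame (h : IsCMGenerators φ x ξ β) :
    LinearIndependent ℚ (powFrame ξ β) := by
  have h1 : LinearIndependent ℚ fun k => coordsLinear φ (powFrame ξ β k) :=
    h.linearIndependent_coords_powFrame.restrict_scalars' ℚ
  exact LinearIndependent.of_comp (coordsLinear φ) h1

theorem finrank_eq (h : IsCMGenerators φ x ξ β) : Module.finrank ℚ K = 8 :=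
  le_antisymm h.finrank_le (by simpa using h.linearIndependent_powFrame.fintype_card_le_finrank)

/-- The elements `ξ^k, β ξ^k` are a basis of `K` over `ℚ`. -/
noncomputable def powBasis (h : IsCMGenerators φ x ξ β) : Module.Basis (Fin 4 ⊕ Fin 4) ℚ K :=
  basisOfLinearIndependentOfCardEqFinrank h.linearIndependent_powFrame (by simp [h.finrank_eq])

theorem powBasis_apply (h : IsCMGenerators φ x ξ β) (k : Fin 4 ⊕ Fin 4) :
    h.powBasis k = powFrame ξ β k := by
  simp [powBasis]

/-- The image of `powBasis` is a real basis of `ℂ⁴`. -/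
noncomputable def powBasisE (h : IsCMGenerators φ x ξ β) : Module.Basis (Fin 4 ⊕ Fin 4) ℝ E :=
  basisOfLinearIndependentOfCardEqFinrank h.linearIndependent_coords_powFrame
    (by rw [Module.finrank_eq_card_basis stdBasisE])

theorem powBasisE_apply (h : IsCMGenerators φ x ξ β) (k : Fin 4 ⊕ Fin 4) :
    h.powBasisE k = coords φ (powFrame ξ β k) := by
  simp [powBasisE]

theorem coords_eq_sum (h : IsCMGenerators φ x ξ β) (y : K) :
    coords φ y = ∑ k, ((h.powBasis.repr y k : ℚ) : ℝ) • h.powBasisE k := by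
  conv_lhs => rw [← h.powBasis.sum_repr y, ← coordsLinear_apply, map_sum]
  refine Finset.sum_congr rfl fun k _ => ?_
  rw [map_smul, powBasis_apply, powBasisE_apply, coordsLinear_apply]
  ext j
  simp [Rat.smul_def]

theorem powBasisE_repr_coords (h : IsCMGenerators φ x ξ β) (y : K) (k : Fin 4 ⊕ Fin 4) :
    h.powBasisE.repr (coords φ y) k = (h.powBasis.repr y k : ℚ) := by
  rw [h.coords_eq_sum, Module.Basis.repr_sum_self]

open MeasureTheory in
/-- The lattice has a basis of rational covolume. -/
theorem exists_isLatticeBasis (h : IsCMGenerators φ x ξ β) {Δ : ℤ}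
    (hΔ : rootDisc x ^ 2 = (Δ : ℝ)) :
    ∃ B : Module.Basis (Fin 8) ℝ E, IsLatticeBasis φ B ∧
      ∃ q : ℚ, volume.real (ZSpan.fundamentalDomain B) = q := by
  have hcard : Fintype.card (Module.Free.ChooseBasisIndex ℤ (NumberField.RingOfIntegers K)) = 8 :=
    by rw [← Module.finrank_eq_card_basis (NumberField.integralBasis K), h.finrank_eq]
  let e := Fintype.equivFinOfCardEq hcard
  let bO := (NumberField.RingOfIntegers.basis K).reindex e
  let bK := (NumberField.integralBasis K).reindex e
  have hbO : ∀ i, ((bO i : NumberField.RingOfIntegers K) : K) = bK i := fun i => by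
    simp [bO, bK, NumberField.integralBasis_apply]
  -- the image of an integral basis spans, because it spans the image of `powBasis`
  have hspan : ⊤ ≤ Submodule.span ℝ (Set.range fun i => coords φ (bK i)) := by
    rw [← h.powBasisE.span_eq, Submodule.span_le]
    rintro _ ⟨k, rfl⟩
    rw [powBasisE_apply, ← coordsLinear_apply, ← bK.sum_repr (powFrame ξ β k), map_sum]
    refine Submodule.sum_mem _ fun i _ => ?_
    rw [map_smul]
    have : bK.repr (powFrame ξ β k) i • (coordsLinear φ) (bK i) =
        ((bK.repr (powFrame ξ β k) i : ℚ) : ℝ) • coords φ (bK i) := by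
      rw [coordsLinear_apply]
      ext j
      simp [Rat.smul_def]
    rw [this]
    exact Submodule.smul_mem _ _ (Submodule.subset_span ⟨i, rfl⟩)
  let B : Module.Basis (Fin 8) ℝ E := basisOfTopLeSpanOfCardEqFinrank _ hspan (by
    rw [Module.finrank_eq_card_basis stdBasisE]; rfl)
  have hB : ∀ i, B i = coords φ (bK i) := fun i => by simp [B]
  refine ⟨B, ?_, ?_⟩
  · ext u
    rw [Submodule.mem_toAddSubgroup]
    constructor
    · intro hu
      induction hu using Submodule.span_induction with
      | mem u hu =>
        obtain ⟨i, rfl⟩ := hu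
        rw [hB, ← hbO]
        exact coords_mem_lattice φ _
      | zero => exact zero_mem _
      | add u v _ _ hu hv => exact add_mem hu hv
      | smul n u _ hu => exact zsmul_mem hu n
    · rintro ⟨y, rfl⟩
      change coordsLinear φ y ∈ _
      rw [← bO.sum_repr y]
      push_cast
      rw [map_sum]
      refine Submodule.sum_mem _ fun i _ => ?_
      rw [map_zsmul]
      change _ • coords φ (bO i : K) ∈ _
      rw [hbO, ← hB]
      exact Submodule.smul_mem _ _ (Submodule.subset_span ⟨i, rfl⟩)
  · let B' := B.reindex (finSumFinEquiv (m := 4) (n := 4)).symm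
    have hB' : ∀ a, B' a = coords φ (bK (finSumFinEquiv a)) := fun a => by simp [B', hB]
    let Q : Matrix (Fin 4 ⊕ Fin 4) (Fin 4 ⊕ Fin 4) ℚ :=
      Matrix.of fun k a => h.powBasis.repr (bK (finSumFinEquiv a)) k
    have hdet : h.powBasisE.det B' = ((Q.det : ℚ) : ℝ) := by
      rw [Module.Basis.det_apply, ← eq_ratCast (algebraMap ℚ ℝ), RingHom.map_det]
      congr 1
      ext k a
      simp [Module.Basis.toMatrix_apply, hB', powBasisE_repr_coords, Q]
    have hdet0 : stdBasisE.det h.powBasisE = ((Δ ^ 3 : ℚ) : ℝ) := by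
      have : ⇑h.powBasisE = fun k => coords φ (powFrame ξ β k) := by
        ext1 k; exact h.powBasisE_apply k
      rw [this, h.det_coords_powFrame]
      push_cast
      rw [← hΔ]
      ring
    refine ⟨|Q.det| * |(Δ ^ 3 : ℚ)|, ?_⟩
    rw [← ZSpan.fundamentalDomain_reindex B (finSumFinEquiv (m := 4) (n := 4)).symm, measureReal_def,
      ZSpan.measure_fundamentalDomain B' volume h.powBasisE,
      ZSpan.measure_fundamentalDomain h.powBasisE volume stdBasisE,
      volume_fundamentalDomain_stdBasisE, hdet, hdet0]
    simp [ENNReal.toReal_mul, ENNReal.toReal_ofReal]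

/-- The lattice of real points has a positively oriented basis, whose determinant is a rational
multiple of `𝔻`. -/
theorem exists_realLatticeBasis (h : IsCMGenerators φ x ξ β) {B : Module.Basis (Fin 8) ℝ E}
    (hB : IsLatticeBasis φ B) (hconj : ∀ l ∈ lattice φ, conjE l ∈ lattice φ) :
    ∃ b : Module.Basis (Fin 4) ℝ (Fin 4 → ℝ), 0 < (Matrix.of b).det ∧
      (∃ q : ℚ, (Matrix.of b).det = q * rootDisc x) ∧
      (∀ i, realPt (b i) ∈ lattice φ) ∧
      ∀ r, realPt r ∈ lattice φ → ∃ n : Fin 4 → ℤ, r = ∑ i, (n i : ℝ) • b i := by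
  have hmem : ∀ u, u ∈ Submodule.span ℤ (Set.range B) ↔ u ∈ lattice φ := fun u => by
    rw [← hB, Submodule.mem_toAddSubgroup]
  let L := ZLattice.comap ℝ (Submodule.span ℤ (Set.range B)) realPt
  have hL : ∀ r, r ∈ L ↔ realPt r ∈ lattice φ := fun r => hmem (realPt r)
  have : DiscreteTopology L := ZLattice.comap_discreteTopology ℝ _
    (LinearMap.continuous_of_finiteDimensional _) (fun r s hrs => by
      ext j
      simpa using congrFun hrs j)
  -- the traces of lattice vectors span the real points
  have : IsZLattice ℝ L := ⟨by
    let re : E →ₗ[ℝ] (Fin 4 → ℝ) :=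
      { toFun := fun u j => (u j).re
        map_add' := fun u v => by ext j; simp
        map_smul' := fun c u => by ext j; simp }
    rw [eq_top_iff]
    intro r _
    have h1 : r = ∑ i, (B.repr (realPt r) i / 2) • (2 • re (B i)) := by
      have : re (realPt r) = r := by ext j; simp [re]
      conv_lhs => rw [← this, ← B.sum_repr (realPt r), map_sum]
      refine Finset.sum_congr rfl fun i _ => ?_
      rw [map_smul]
      ext j
      simp
      ring
    rw [h1]
    refine Submodule.sum_mem _ fun i _ => Submodule.smul_mem _ _ (Submodule.subset_span ?_)
    rw [SetLike.mem_coe, hL]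
    have hBi : B i ∈ lattice φ := (hmem _).mp (Submodule.subset_span ⟨i, rfl⟩)
    have : realPt (2 • re (B i)) = B i + conjE (B i) := by
      ext j
      simp [re, conjE, Complex.add_conj]
    rw [this]
    exact add_mem hBi (hconj _ hBi)⟩
  have hcard : Fintype.card (Module.Free.ChooseBasisIndex ℤ L) = 4 := by
    rw [← Module.finrank_eq_card_chooseBasisIndex, ZLattice.rank ℝ L]
    simp
  let bz := (Module.Free.chooseBasis ℤ L).reindex (Fintype.equivFinOfCardEq hcard)
  -- a transposition makes the orientation positive
  have horient : ∃ bz : Module.Basis (Fin 4) ℤ L,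
      0 < (Matrix.of (bz.ofZLatticeBasis ℝ L)).det := by
    have hne : (Matrix.of (bz.ofZLatticeBasis ℝ L)).det ≠ 0 := by
      have := (bz.ofZLatticeBasis ℝ L).linearIndependent
      exact (Matrix.linearIndependent_rows_iff_isUnit.mp this |>.map Matrix.detMonoidHom).ne_zero
    rcases lt_or_gt_of_ne hne with hneg | hpos
    · refine ⟨bz.reindex (Equiv.swap 0 1), ?_⟩
      have : Matrix.of ((bz.reindex (Equiv.swap 0 1)).ofZLatticeBasis ℝ L) =
          (Matrix.of (bz.ofZLatticeBasis ℝ L)).submatrix (Equiv.swap 0 1) id := by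
        ext i j
        simp [Module.Basis.ofZLatticeBasis_apply]
      rw [this, Matrix.det_permute, Equiv.Perm.sign_swap (by decide)]
      simpa using hneg
    · exact ⟨bz, hpos⟩
  obtain ⟨bz, hpos⟩ := horient
  have hbz : ∀ i, bz.ofZLatticeBasis ℝ L i = bz i := fun i => bz.ofZLatticeBasis_apply ℝ L i
  refine ⟨bz.ofZLatticeBasis ℝ L, hpos, ?_, fun i => ?_, fun r hr => ?_⟩
  · have hy : ∀ i, ∃ y : K, coords φ y = realPt (bz.ofZLatticeBasis ℝ L i) := fun i => by
      have := (hL _).mp (bz i).2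
      rw [hbz]
      obtain ⟨y, hy⟩ := this
      exact ⟨y, hy⟩
    choose y hy using hy
    let Q : Matrix (Fin 4) (Fin 4) ℚ := Matrix.of fun i k => h.powBasis.repr (y i) (.inl k)
    have hQ : Matrix.of (bz.ofZLatticeBasis ℝ L) =
        (algebraMap ℚ ℝ).mapMatrix Q * (Matrix.vandermonde x).transpose := by
      ext i j
      have h1 := congrFun (hy i) j
      rw [h.coords_eq_sum, Fintype.sum_sum_type] at h1
      have h2 := congrArg Complex.re h1
      simp only [Pi.add_apply, Finset.sum_apply, Pi.smul_apply, powBasisE_apply,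
        h.coords_powFrame_inl, h.coords_powFrame_inr, Complex.add_re, Complex.re_sum,
        Complex.smul_re, Complex.ofReal_re, Complex.re_ofReal_mul, Complex.I_re, mul_zero,
        smul_zero, Finset.sum_const_zero, add_zero, realPt_apply] at h2
      rw [Matrix.of_apply, ← h2, Matrix.mul_apply]
      simp [Q, Matrix.vandermonde_apply]
    refine ⟨Q.det, ?_⟩
    rw [hQ, Matrix.det_mul, Matrix.det_transpose, det_vandermonde_eq_rootDisc, ← RingHom.map_det]
    simp
  · rw [hbz]
    exact (hL _).mp (bz i).2
  · refine ⟨fun i => bz.repr ⟨r, (hL r).mpr hr⟩ i, ?_⟩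
    have := congrArg Subtype.val (bz.sum_repr ⟨r, (hL r).mpr hr⟩)
    simp only [AddSubmonoidClass.coe_finsetSum, Submodule.coe_smul] at this
    refine this.symm.trans (Finset.sum_congr rfl fun i _ => ?_)
    rw [hbz]
    ext j
    simp

end IsCMGenerators

end Lattice

/-! ### The fixed locus of complex conjugation -/

@[simp] theorem conjE_zero : conjE 0 = 0 := by ext j; simp [conjE]

theorem conjE_add (u v : E) : conjE (u + v) = conjE u + conjE v := by ext j; simp [conjE]

theorem conjE_sub (u v : E) : conjE (u - v) = conjE u - conjE v := by ext j; simp [conjE]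

theorem conjE_realPt (r : Fin 4 → ℝ) : conjE (realPt r) = realPt r := by ext j; simp [conjE]

theorem norm_conjE_le (u : E) : ‖conjE u‖ ≤ ‖u‖ := by
  rw [pi_norm_le_iff_of_nonneg (norm_nonneg _)]
  intro j
  simpa [conjE] using norm_le_pi_norm u j

theorem conjE_eq_self_iff {u : E} : conjE u = u ↔ u ∈ LinearMap.range realPt := by
  constructor
  · intro h
    refine ⟨fun j => (u j).re, ?_⟩
    ext j
    exact Complex.conj_eq_iff_re.mp (congrFun h j)
  · rintro ⟨r, rfl⟩
    exact conjE_realPt r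

section FixedLocus

variable {K : Type} [Field K] {φ : Fin 4 → K →+* ℂ}

theorem proj_eq_proj_iff {u v : E} : proj φ u = proj φ v ↔ u - v ∈ lattice φ := by
  rw [eq_comm, proj, proj, QuotientAddGroup.eq, neg_add_eq_sub]

theorem continuous_proj : Continuous (proj φ) := continuous_quot_mk

/-- The antiholomorphic involution of `X` induced by complex conjugation. -/
def conjTorus (hconj : ∀ l ∈ lattice φ, conjE l ∈ lattice φ) : CMTorus φ → CMTorus φ :=
  QuotientAddGroup.map (lattice φ) (lattice φ)
    { toFun := conjE, map_zero' := conjE_zero, map_add' := conjE_add } hconj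

theorem conjTorus_proj (hconj : ∀ l ∈ lattice φ, conjE l ∈ lattice φ) (u : E) :
    conjTorus hconj (proj φ u) = proj φ (conjE u) := rfl

theorem proj_mem_fixedPoints_iff (hconj : ∀ l ∈ lattice φ, conjE l ∈ lattice φ) {u : E} :
    proj φ u ∈ Function.fixedPoints (conjTorus hconj) ↔ conjE u - u ∈ lattice φ := by
  rw [Function.mem_fixedPoints, Function.IsFixedPt, conjTorus_proj, proj_eq_proj_iff]

theorem IsLatticeBasis.mem_iff {B : Module.Basis (Fin 8) ℝ E} (hB : IsLatticeBasis φ B) {u : E} :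
    u ∈ Submodule.span ℤ (Set.range B) ↔ u ∈ lattice φ := by
  rw [← hB, Submodule.mem_toAddSubgroup]

theorem exists_forall_mem_lattice_norm_lt {B : Module.Basis (Fin 8) ℝ E}
    (hB : IsLatticeBasis φ B) : ∃ ε > 0, ∀ l ∈ lattice φ, ‖l‖ < ε → l = 0 := by
  obtain ⟨ε, hε, h⟩ := Metric.isOpen_singleton_iff.mp
    (isOpen_discrete ({0} : Set (Submodule.span ℤ (Set.range B))))
  refine ⟨ε, hε, fun l hl hlε => ?_⟩
  rw [← hB] at hl
  have := h ⟨l, hl⟩ (by simpa [Subtype.dist_eq] using hlε)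
  exact congrArg Subtype.val this

/-- Near each of its points the fixed locus is a translate of `ℝ⁴`. -/
theorem isCalibratedSubmanifold_fixedPoints {B : Module.Basis (Fin 8) ℝ E}
    (hB : IsLatticeBasis φ B) (hconj : ∀ l ∈ lattice φ, conjE l ∈ lattice φ)
    {g : E → E → ℝ} {Φ : E [⋀^Fin 4]→ₗ[ℝ] ℝ}
    (hcal : IsCalibratedFrame g Φ fun i => realPt (Pi.single i 1)) :
    IsCalibratedSubmanifold φ g Φ (Function.fixedPoints (conjTorus hconj)) := by
  intro p hp
  rw [proj_mem_fixedPoints_iff] at hp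
  obtain ⟨ε, hε, hsmall⟩ := exists_forall_mem_lattice_norm_lt hB
  let e : OpenPartialHomeomorph E E :=
    (Homeomorph.addRight (-p)).toOpenPartialHomeomorph.restrOpen (Metric.ball p (ε / 2))
      Metric.isOpen_ball
  have he : ⇑e = fun q => q + -p := rfl
  have hsource : e.source = Metric.ball p (ε / 2) := by simp [e]
  have hsymm : ⇑e.symm = fun q => q + - -p := rfl
  refine ⟨e, LinearMap.range realPt, ?_, ?_, ?_, ?_, ?_⟩
  · rw [hsource]
    exact Metric.mem_ball_self (by positivity)
  · rw [he]
    exact (contDiff_id.add contDiff_const).contDiffOn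
  · rw [hsymm]
    exact (contDiff_id.add contDiff_const).contDiffOn
  · intro q hq
    rw [hsource, mem_ball_iff_norm] at hq
    have heq : e q = q - p := (sub_eq_add_neg q p).symm
    rw [proj_mem_fixedPoints_iff, heq, ← conjE_eq_self_iff, conjE_sub]
    constructor
    · intro h
      have h1 : conjE (q - p) - (q - p) ∈ lattice φ := by
        rw [conjE_sub, sub_sub_sub_comm]
        exact sub_mem h hp
      have h2 : ‖conjE (q - p) - (q - p)‖ < ε := by
        have := norm_conjE_le (q - p)
        have := norm_sub_le (conjE (q - p)) (q - p)
        linarith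
      rw [← conjE_sub]
      exact sub_eq_zero.mp (hsmall _ h1 h2)
    · intro h
      have : conjE q - q = conjE p - p := by
        rw [sub_eq_sub_iff_sub_eq_sub]
        exact h
      rw [this]
      exact hp
  · intro q _ _
    refine ⟨_, hcal, ?_⟩
    have hd : fderiv ℝ e q = ContinuousLinearMap.id ℝ E := by
      rw [he, fderiv_add_const]
      exact fderiv_fun_id
    rw [hd]
    change _ = Submodule.comap LinearMap.id _
    rw [Submodule.comap_id]
    have : (fun i : Fin 4 => realPt (Pi.single i 1)) = realPt ∘ Pi.basisFun ℝ (Fin 4) := by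
      ext i j; simp
    rw [this, Set.range_comp, ← Submodule.map_span, Module.Basis.span_eq, LinearMap.range_eq_map]

/-- The components of the fixed locus: there are finitely many classes of fixed points modulo
translation by `ℝ⁴`. -/
theorem exists_fixed_representatives {B : Module.Basis (Fin 8) ℝ E} (hB : IsLatticeBasis φ B) :
    ∃ (n : ℕ) (p : Fin n → E), (∀ k, conjE (p k) - p k ∈ lattice φ) ∧
      (∀ k l r, p k - p l - realPt r ∈ lattice φ → k = l) ∧
      ∀ u, conjE u - u ∈ lattice φ → ∃ k r, u - p k - realPt r ∈ lattice φ := by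
  let S := {u : E // conjE u - u ∈ lattice φ}
  let s : Setoid S :=
    { r := fun u v => ∃ r, (u : E) - v - realPt r ∈ lattice φ
      iseqv :=
        { refl := fun u => ⟨0, by simp⟩
          symm := fun {u v} ⟨r, hr⟩ => ⟨-r, by
            have := neg_mem hr
            rw [map_neg]
            convert this using 1
            abel⟩
          trans := fun {u v w} ⟨r, hr⟩ ⟨t, ht⟩ => ⟨r + t, by
            have := add_mem hr ht
            rw [map_add]
            convert this using 1
            abel⟩ } }
  have hcoef : ∀ u : S, ∃ c : Fin 8 → ℤ, ∑ i, c i • B i = conjE (u : E) - u := fun u => by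
    exact (Submodule.mem_span_range_iff_exists_fun ℤ).mp (hB.mem_iff.mpr u.2)
  choose c hc using hcoef
  -- the class of `u` is determined by the class of `ū - u` modulo `2Λ`
  have hinj : Function.Injective fun (q : Quotient s) (i : Fin 8) => (c q.out i : ZMod 2) := by
    intro q q' hqq
    have hdvd : ∀ i, ∃ m : ℤ, c q.out i - c q'.out i = 2 * m := fun i => by
      have h1 := congrFun hqq i
      have h2 : ((c q.out i - c q'.out i : ℤ) : ZMod 2) = 0 := by
        push_cast
        exact sub_eq_zero.mpr h1
      exact (ZMod.intCast_zmod_eq_zero_iff_dvd _ 2).mp h2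
    choose m hm using hdvd
    have hmem : ∑ i, m i • B i ∈ lattice φ := by
      rw [← hB.mem_iff]
      exact Submodule.sum_mem _ fun i _ =>
        Submodule.smul_mem _ _ (Submodule.subset_span ⟨i, rfl⟩)
    have h2 : (conjE (q.out : E) - q.out) - (conjE (q'.out : E) - q'.out) =
        (2 : ℤ) • ∑ i, m i • B i := by
      rw [← hc, ← hc, ← Finset.sum_sub_distrib, Finset.smul_sum]
      refine Finset.sum_congr rfl fun i _ => ?_
      rw [← sub_smul, hm, mul_smul]
    rw [← Quotient.out_equiv_out]
    refine ⟨fun j => ((q.out : E) j - (q'.out : E) j).re, ?_⟩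
    have h3 : (q.out : E) - q'.out -
        realPt (fun j => ((q.out : E) j - (q'.out : E) j).re) = -∑ i, m i • B i := by
      ext j
      have h4 := congrFun h2 j
      simp only [Pi.sub_apply, Pi.smul_apply, conjE] at h4
      simp only [Pi.sub_apply, realPt_apply, Pi.neg_apply]
      rw [Complex.re_eq_add_conj, map_sub]
      rw [zsmul_eq_mul] at h4
      push_cast at h4
      linear_combination (-1 / 2 : ℂ) * h4
    rw [h3]
    exact neg_mem hmem
  have hfin : Finite (Quotient s) := Finite.of_injective _ hinj
  obtain ⟨n, ⟨e⟩⟩ := Finite.exists_equiv_fin (Quotient s)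
  refine ⟨n, fun k => ((e.symm k).out : E), fun k => (e.symm k).out.2, ?_, ?_⟩
  · rintro k l r hr
    have : (e.symm k).out ≈ (e.symm l).out := ⟨r, hr⟩
    rw [Quotient.out_equiv_out] at this
    exact e.symm.injective this
  · intro u hu
    obtain ⟨r, hr⟩ := Setoid.symm (Quotient.mk_out (s := s) ⟨u, hu⟩)
    exact ⟨e (Quotient.mk s ⟨u, hu⟩), r, by simpa using hr⟩

/-! ### Affine tori and their cycles -/

/-- The torus `t ↦ p + t₁ v₁ + ⋯ + t₄ v₄` in `X`. -/
noncomputable def affineTorus (φ : Fin 4 → K →+* ℂ) (p : E) (v : Fin 4 → E)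
    (hv : ∀ i, v i ∈ lattice φ) : SmoothTorus φ where
  toFun t := p + frameMap v t
  smooth := contDiff_const.add (frameMap v).contDiff
  periodic t n := by
    rw [map_add, add_sub_add_left_eq_sub, add_sub_cancel_left, frameMap_apply]
    refine sum_mem fun i _ => ?_
    rw [Int.cast_smul_eq_zsmul]
    exact zsmul_mem (hv i) _

theorem affineTorus_frame (p : E) (v : Fin 4 → E) (hv : ∀ i, v i ∈ lattice φ) (t : Fin 4 → ℝ) :
    (affineTorus φ p v hv).frame t = v := by
  ext1 i
  rw [SmoothTorus.frame, affineTorus, fderiv_const_add, ContinuousLinearMap.fderiv,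
    frameMap_single]

theorem affineTorus_integral (p : E) (v : Fin 4 → E) (hv : ∀ i, v i ∈ lattice φ)
    (ξ : E → E [⋀^Fin 4]→L[ℝ] ℂ) : (affineTorus φ p v hv).integral ξ =
      ∫ t in Set.Icc (0 : Fin 4 → ℝ) 1, ξ (p + frameMap v t) v := by
  simp only [SmoothTorus.integral, affineTorus_frame]
  rfl

theorem affineTorus_integral_const (p : E) (v : Fin 4 → E) (hv : ∀ i, v i ∈ lattice φ)
    (A : E [⋀^Fin 4]→L[ℝ] ℂ) : (affineTorus φ p v hv).integral (fun _ => A) = A v := by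
  rw [affineTorus_integral, MeasureTheory.setIntegral_const]
  simp [MeasureTheory.measureReal_def, Real.volume_Icc_pi]

theorem mul_mem_lattice (α : NumberField.RingOfIntegers K) {l : E} (hl : l ∈ lattice φ) :
    coords φ (α : K) * l ∈ lattice φ := by
  obtain ⟨y, rfl⟩ := hl
  refine ⟨α * y, ?_⟩
  ext j
  simp [coords]

theorem affineTorus_push (α : NumberField.RingOfIntegers K) (p : E) (v : Fin 4 → E)
    (hv : ∀ i, v i ∈ lattice φ) :
    (affineTorus φ p v hv).push α =
      affineTorus φ (coords φ (α : K) * p) (fun i => coords φ (α : K) * v i)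
        (fun i => mul_mem_lattice α (hv i)) := by
  simp only [SmoothTorus.push, affineTorus, SmoothTorus.mk.injEq]
  ext t j
  simp only [frameMap_apply, Pi.mul_apply, Pi.add_apply, Finset.sum_apply, Pi.smul_apply, mul_add,
    Finset.mul_sum, mul_smul_comm]

/-- The fixed locus is the disjoint union of finitely many translates of `ℝ⁴ / (Λ ∩ ℝ⁴)`. -/
theorem exists_parametrizes_fixedPoints {B : Module.Basis (Fin 8) ℝ E} (hB : IsLatticeBasis φ B)
    (hconj : ∀ l ∈ lattice φ, conjE l ∈ lattice φ) (b : Module.Basis (Fin 4) ℝ (Fin 4 → ℝ))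
    (hb : ∀ i, realPt (b i) ∈ lattice φ)
    (hgen : ∀ r, realPt r ∈ lattice φ → ∃ n : Fin 4 → ℤ, r = ∑ i, (n i : ℝ) • b i) :
    ∃ (n : ℕ) (p : Fin n → E), n ≠ 0 ∧ Parametrizes
      (fun k => affineTorus φ (p k) (fun i => realPt (b i)) hb)
      (Function.fixedPoints (conjTorus hconj)) := by
  obtain ⟨n, p, hp, hdisj, hcover⟩ := exists_fixed_representatives hB
  have hreal : ∀ t, frameMap (fun i => realPt (b i)) t = realPt (∑ i, t i • b i) := fun t => by
    rw [map_sum, frameMap_apply]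
    simp only [map_smul]
  have htoFun : ∀ k t, (affineTorus φ (p k) (fun i => realPt (b i)) hb).toFun t =
      p k + realPt (∑ i, t i • b i) := fun k t => by rw [← hreal]; rfl
  refine ⟨n, p, ?_, fun k s t hst => ?_, fun k l hkl => ?_, ?_⟩
  · obtain ⟨k, -⟩ := hcover 0 (by simp)
    exact (Fin.pos k).ne'
  · rw [htoFun, htoFun, proj_eq_proj_iff, add_sub_add_left_eq_sub, ← map_sub] at hst
    obtain ⟨m, hm⟩ := hgen _ hst
    refine ⟨m, ?_⟩
    rw [← Finset.sum_sub_distrib] at hm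
    simp only [← sub_smul] at hm
    ext i
    have := congrArg (fun r => b.repr r i) hm
    simp only [Module.Basis.repr_sum_self] at this
    simp only [Pi.add_apply]
    linarith
  · refine Set.disjoint_left.mpr ?_
    rintro _ ⟨s, rfl⟩ ⟨t, ht⟩
    change proj φ ((affineTorus φ (p l) _ hb).toFun t) =
      proj φ ((affineTorus φ (p k) _ hb).toFun s) at ht
    rw [htoFun, htoFun, proj_eq_proj_iff] at ht
    refine hkl (hdisj l k (∑ i, s i • b i - ∑ i, t i • b i) ?_).symm
    rw [map_sub]
    convert ht using 1
    abel
  · ext z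
    rw [Set.mem_iUnion]
    obtain ⟨u, rfl⟩ := QuotientAddGroup.mk_surjective z
    change _ ↔ proj φ u ∈ _
    rw [proj_mem_fixedPoints_iff]
    constructor
    · rintro ⟨k, t, ht⟩
      change proj φ _ = proj φ u at ht
      rw [htoFun, proj_eq_proj_iff] at ht
      have h1 := sub_mem (hp k) (sub_mem (hconj _ ht) ht)
      convert h1 using 1
      rw [conjE_sub, conjE_add, conjE_realPt]
      abel
    · intro hu
      obtain ⟨k, r, hr⟩ := hcover u hu
      refine ⟨k, fun i => b.repr r i, ?_⟩
      change proj φ _ = proj φ u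
      rw [htoFun, b.sum_repr, eq_comm, proj_eq_proj_iff]
      convert hr using 1
      abel

theorem SmoothTorus.isCompact_image (T : SmoothTorus φ) : IsCompact T.image := by
  have h : T.image = (fun t => proj φ (T.toFun t)) '' Set.Icc 0 1 := by
    refine Set.Subset.antisymm ?_ (Set.image_subset_range _ _)
    rintro _ ⟨t, rfl⟩
    refine ⟨fun i => Int.fract (t i), ⟨fun i => Int.fract_nonneg _, fun i => (Int.fract_lt_one _).le⟩,
      ?_⟩
    have h1 : t = (fun i => Int.fract (t i)) + fun i => ((⌊t i⌋ : ℤ) : ℝ) := by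
      ext i; exact (Int.fract_add_floor (t i)).symm
    have h2 := T.periodic (fun i => Int.fract (t i)) (fun i => ⌊t i⌋)
    rw [← h1] at h2
    exact (proj_eq_proj_iff.mpr h2).symm
  rw [h]
  exact isCompact_Icc.image (continuous_proj.comp T.smooth.continuous)

end FixedLocus

/-! ### The number field -/

section NumberField

open Polynomial

/-- The four real roots are all the complex roots. -/
theorem exists_eq_root {P : ℚ[X]} (hP0 : P ≠ 0) (hdeg : P.natDegree ≤ 4) {x : Fin 4 → ℝ}
    (hx : StrictAnti x) (hroot : ∀ j, aeval (x j) P = 0) {z : ℂ} (hz : aeval z P = 0) :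
    ∃ j, z = x j := by
  classical
  have hroot' : ∀ j, aeval (x j : ℂ) P = 0 := fun j => by
    rw [show (x j : ℂ) = algebraMap ℝ ℂ (x j) from rfl, aeval_algebraMap_apply, hroot, map_zero]
  have hsub : Finset.univ.image (fun j => (x j : ℂ)) ⊆ (P.aroots ℂ).toFinset := by
    intro w hw
    obtain ⟨j, -, rfl⟩ := Finset.mem_image.mp hw
    rw [Multiset.mem_toFinset, mem_aroots]
    exact ⟨hP0, hroot' j⟩
  have hcard : (P.aroots ℂ).toFinset.card ≤ (Finset.univ.image (fun j => (x j : ℂ))).card := by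
    rw [Finset.card_image_of_injective _ fun i j hij => hx.injective (Complex.ofReal_injective hij)]
    calc (P.aroots ℂ).toFinset.card ≤ (P.aroots ℂ).card := Multiset.toFinset_card_le _
      _ ≤ (P.map (algebraMap ℚ ℂ)).natDegree := card_roots' _
      _ ≤ 4 := natDegree_map_le.trans hdeg
  have hmem : z ∈ (P.aroots ℂ).toFinset := by
    rw [Multiset.mem_toFinset, mem_aroots]
    exact ⟨hP0, hz⟩
  rw [← Finset.eq_of_subset_of_card_le hsub hcard] at hmem
  obtain ⟨j, -, rfl⟩ := Finset.mem_image.mp hmem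
  exact ⟨j, rfl⟩

/-- When the Galois group is the full symmetric group, `𝔻` is not rational, because odd
permutations change its sign; in particular `Δ = 1` does not occur. -/
theorem disc_ne_one {P : ℚ[X]} (hP0 : P ≠ 0) (hdeg : P.natDegree ≤ 4)
    (hGal : Nonempty (P.Gal ≃* Equiv.Perm (Fin 4))) {x : Fin 4 → ℝ}
    (hx : StrictAnti x) (hroot : ∀ j, aeval (x j) P = 0) {Δ : ℤ}
    (hΔ : rootDisc x ^ 2 = (Δ : ℝ)) : Δ ≠ 1 := by
  rintro rfl
  have hD : rootDisc x = 1 := by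
    have := rootDisc_pos hx
    push_cast at hΔ
    nlinarith
  let A := algebraicClosure ℚ ℂ
  have : IsAlgClosed A := (algebraicClosure.isAlgClosure ℚ ℂ).isAlgClosed
  have : Algebra.IsAlgebraic ℚ A := by convert! algebraicClosure.isAlgebraic ℚ ℂ
  have : Normal ℚ A := normal_iff.mpr fun z =>
    ⟨Algebra.IsIntegral.isIntegral z, IsAlgClosed.splits _⟩
  have hsplit : Fact ((P.map (algebraMap ℚ A)).Splits) := ⟨IsAlgClosed.splits _⟩
  have hroot' : ∀ j, aeval (x j : ℂ) P = 0 := fun j => by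
    rw [show (x j : ℂ) = algebraMap ℝ ℂ (x j) from rfl, aeval_algebraMap_apply, hroot, map_zero]
  have hA : ∀ j, (x j : ℂ) ∈ A := fun j => by
    rw [mem_algebraicClosure_iff]
    exact ⟨P, hP0, hroot' j⟩
  let X : Fin 4 → P.rootSet A := fun j => ⟨⟨x j, hA j⟩, by
    rw [mem_rootSet]
    refine ⟨hP0, ?_⟩
    apply (algebraMap A ℂ).injective
    rw [map_zero, ← aeval_algebraMap_apply]
    exact hroot' j⟩
  have hXval : ∀ j, (((X j : P.rootSet A) : A) : ℂ) = x j := fun j => rfl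
  have hX : Function.Bijective X := by
    constructor
    · intro i j hij
      have : (x i : ℂ) = x j := by rw [← hXval, ← hXval, hij]
      exact hx.injective (by exact_mod_cast this)
    · rintro ⟨z, hz⟩
      have hz' : aeval (z : ℂ) P = 0 := by
        have := (mem_rootSet.mp hz).2
        rw [show (z : ℂ) = algebraMap A ℂ z from rfl, aeval_algebraMap_apply, this, map_zero]
      obtain ⟨j, hj⟩ := exists_eq_root hP0 hdeg hx hroot hz'
      exact ⟨j, Subtype.ext (Subtype.ext hj.symm)⟩
  let e := Equiv.ofBijective X hX
  have hsurj : Function.Surjective (Gal.galActionHom P A) := by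
    have hbij := (Nat.bijective_iff_injective_and_card (Gal.galActionHom P A)).mpr
      ⟨Gal.galActionHom_injective P A, by
        rw [Nat.card_congr hGal.some.toEquiv, Nat.card_congr e.permCongr]⟩
    exact hbij.2
  obtain ⟨g, hg⟩ := hsurj (e.permCongr (Equiv.swap 0 1))
  obtain ⟨τ, rfl⟩ := Gal.restrict_surjective P A g
  have hτ : ∀ j, τ (X j : A) = X (Equiv.swap 0 1 j) := fun j => by
    rw [← Gal.restrict_smul τ (X j)]
    have := congrArg (fun p : Equiv.Perm (P.rootSet A) => p (X j)) hg
    have h2 : e.symm (X j) = j := e.symm_apply_apply j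
    simp only [Equiv.permCongr_apply, h2] at this
    exact congrArg Subtype.val this
  let D : A := ((X 0 : A) - X 1) * ((X 0 : A) - X 2) * ((X 0 : A) - X 3) * ((X 1 : A) - X 2) *
    ((X 1 : A) - X 3) * ((X 2 : A) - X 3)
  have hD1 : D = 1 := by
    apply Subtype.ext
    have : (D : ℂ) = (rootDisc x : ℂ) := by simp [D, hXval, rootDisc]
    rw [this, hD]
    simp
  have hD2 : τ D = -D := by
    have h0 := hτ 0
    have h1 := hτ 1
    have h2 := hτ 2
    have h3 := hτ 3
    rw [show Equiv.swap (0 : Fin 4) 1 0 = 1 by decide] at h0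
    rw [show Equiv.swap (0 : Fin 4) 1 1 = 0 by decide] at h1
    rw [show Equiv.swap (0 : Fin 4) 1 2 = 2 by decide] at h2
    rw [show Equiv.swap (0 : Fin 4) 1 3 = 3 by decide] at h3
    simp only [D, map_mul, map_sub, h0, h1, h2, h3]
    ring
  rw [hD1, map_one] at hD2
  have h3 : (1 : A) + 1 = 0 := by nth_rewrite 1 [hD2]; ring
  norm_num at h3

section Field

variable {x : Fin 4 → ℝ}

/-- The element `x₁` of `F`. -/
def cmRoot (x : Fin 4 → ℝ) : cmField x :=
  ⟨x 0, IntermediateField.subset_adjoin _ _ (Set.mem_insert _ _)⟩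

/-- The element `i𝔻` of `F`. -/
def cmDisc (x : Fin 4 → ℝ) : cmField x :=
  ⟨Complex.I * rootDisc x, IntermediateField.subset_adjoin _ _ (Set.mem_insert_of_mem _ rfl)⟩

theorem cmField_hom_ext {f g : cmField x →+* ℂ} (h1 : f (cmRoot x) = g (cmRoot x))
    (h2 : f (cmDisc x) = g (cmDisc x)) : f = g := by
  have : f.toRatAlgHom = g.toRatAlgHom := by
    apply IntermediateField.algHom_ext_of_eq_adjoin ℚ (S := cmField x)
      (s := {(x 0 : ℂ), Complex.I * (rootDisc x : ℂ)}) rfl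
    rintro z (rfl | rfl)
    · exact h1
    · exact h2
  ext y
  exact congrArg (fun f => f y) this

theorem cmDisc_sq {Δ : ℤ} (hΔ : rootDisc x ^ 2 = (Δ : ℝ)) : cmDisc x ^ 2 = -Δ := by
  apply Subtype.ext
  have h : (rootDisc x : ℂ) ^ 2 = Δ := by exact_mod_cast hΔ
  simp [cmDisc, mul_pow, h]

theorem numberField_cmField {P : ℚ[X]} (hP0 : P ≠ 0) (hroot : ∀ j, aeval (x j) P = 0)
    {Δ : ℤ} (hΔ : rootDisc x ^ 2 = (Δ : ℝ)) : NumberField (cmField x) := by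
  have : FiniteDimensional ℚ (cmField x) := by
    apply IntermediateField.finiteDimensional_adjoin
    rintro z (rfl | rfl)
    · refine IsAlgebraic.isIntegral ⟨P, hP0, ?_⟩
      rw [show (x 0 : ℂ) = algebraMap ℝ ℂ (x 0) from rfl, aeval_algebraMap_apply, hroot, map_zero]
    · refine IsIntegral.of_pow (n := 2) (by norm_num) ?_
      have h : (rootDisc x : ℂ) ^ 2 = Δ := by exact_mod_cast hΔ
      rw [mul_pow, h, Complex.I_sq]
      have := isIntegral_algebraMap (R := ℚ) (A := ℂ) (x := -(Δ : ℚ))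
      simpa using this
  exact { to_charZero := inferInstance, to_finiteDimensional := by convert! this }

theorem conj_mem_cmField {z : ℂ} (hz : z ∈ cmField x) : (starRingEnd ℂ) z ∈ cmField x := by
  let c : ℂ →ₐ[ℚ] ℂ := (starRingEnd ℂ).toRatAlgHom
  have h : cmField x ≤ (cmField x).comap c := by
    conv_lhs => rw [cmField]
    rw [IntermediateField.adjoin_le_iff]
    rintro z (rfl | rfl)
    · change (starRingEnd ℂ) (x 0 : ℂ) ∈ cmField x
      rw [Complex.conj_ofReal]
      exact (cmRoot x).2
    · change (starRingEnd ℂ) (Complex.I * rootDisc x) ∈ cmField x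
      rw [map_mul, Complex.conj_ofReal, Complex.conj_I, neg_mul]
      exact neg_mem (cmDisc x).2
  exact h hz

/-- Complex conjugation on `F`. -/
def cmConj (x : Fin 4 → ℝ) : cmField x ≃+* cmField x where
  toFun y := ⟨(starRingEnd ℂ) y, conj_mem_cmField y.2⟩
  invFun y := ⟨(starRingEnd ℂ) y, conj_mem_cmField y.2⟩
  left_inv y := by ext; simp
  right_inv y := by ext; simp
  map_mul' y z := by ext; simp
  map_add' y z := by ext; simp

theorem cmConj_root : cmConj x (cmRoot x) = cmRoot x := by
  apply Subtype.ext
  exact Complex.conj_ofReal _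

theorem cmConj_disc : cmConj x (cmDisc x) = -cmDisc x := by
  apply Subtype.ext
  change (starRingEnd ℂ) (Complex.I * rootDisc x) = -(Complex.I * rootDisc x)
  rw [map_mul, Complex.conj_ofReal, Complex.conj_I, neg_mul]

theorem aeval_hom_root {P : ℚ[X]} (hroot : ∀ j, aeval (x j) P = 0) (f : cmField x →+* ℂ) :
    aeval (f (cmRoot x)) P = 0 := by
  have h0 : aeval (cmRoot x) P = 0 := by
    apply (algebraMap (cmField x) ℂ).injective
    rw [map_zero, ← aeval_algebraMap_apply]
    change aeval (algebraMap ℝ ℂ (x 0)) P = 0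
    rw [aeval_algebraMap_apply, hroot, map_zero]
  have := aeval_algHom_apply f.toRatAlgHom (cmRoot x) P
  rw [h0, map_zero] at this
  exact this

theorem hom_disc_eq {Δ : ℤ} (hΔ : rootDisc x ^ 2 = (Δ : ℝ)) (f : cmField x →+* ℂ) :
    f (cmDisc x) = Complex.I * rootDisc x ∨ f (cmDisc x) = -(Complex.I * rootDisc x) := by
  rw [← sq_eq_sq_iff_eq_or_eq_neg, ← map_pow, cmDisc_sq hΔ, mul_pow, Complex.I_sq]
  have h : (rootDisc x : ℂ) ^ 2 = Δ := by exact_mod_cast hΔ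
  simp [h]

theorem finrank_cmField_le [NumberField (cmField x)] {P : ℚ[X]} (hP0 : P ≠ 0)
    (hdeg : P.natDegree ≤ 4) (hx : StrictAnti x) (hroot : ∀ j, aeval (x j) P = 0)
    {Δ : ℤ} (hΔ : rootDisc x ^ 2 = (Δ : ℝ)) : Module.finrank ℚ (cmField x) ≤ 8 := by
  classical
  rw [← NumberField.Embeddings.card (cmField x) ℂ]
  -- an embedding is determined by a root of `P` and a sign
  have hj : ∀ f : cmField x →+* ℂ, ∃ j, f (cmRoot x) = x j := fun f =>
    exists_eq_root hP0 hdeg hx hroot (aeval_hom_root hroot f)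
  choose j hj using hj
  let F : (cmField x →+* ℂ) → Fin 4 × Bool := fun f =>
    (j f, decide (f (cmDisc x) = Complex.I * rootDisc x))
  have hF : Function.Injective F := by
    intro f g hfg
    simp only [F, Prod.mk.injEq, decide_eq_decide] at hfg
    refine cmField_hom_ext (by rw [hj, hj, hfg.1]) ?_
    by_cases h : f (cmDisc x) = Complex.I * rootDisc x
    · rw [h, hfg.2.mp h]
    · rw [(hom_disc_eq hΔ f).resolve_left h,
        (hom_disc_eq hΔ g).resolve_left (fun h' => h (hfg.2.mpr h'))]
  simpa using Fintype.card_le_of_injective F hF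

/-- The embeddings exist because all roots of an irreducible polynomial are conjugate, and
conjugation on `F` can be used to adjust the sign of `i𝔻`. -/
theorem exists_embedding [NumberField (cmField x)] {P : ℚ[X]} (hirr : Irreducible P)
    (hroot : ∀ j, aeval (x j) P = 0) {Δ : ℤ} (hΔ : rootDisc x ^ 2 = (Δ : ℝ)) (j : Fin 4) :
    ∃ f : cmField x →+* ℂ, f (cmRoot x) = x j ∧
      f (cmDisc x) = (-1) ^ (j : ℕ) * (Complex.I * rootDisc x) := by
  have hmin : P ∣ minpoly ℚ (cmRoot x) := by
    have h1 : minpoly ℚ (cmRoot x) ∣ P := minpoly.dvd _ _ (by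
      apply (algebraMap (cmField x) ℂ).injective
      rw [map_zero, ← aeval_algebraMap_apply]
      exact aeval_hom_root hroot (algebraMap (cmField x) ℂ))
    exact (hirr.dvd_iff.mp h1).resolve_left (minpoly.not_isUnit _ _) |>.dvd
  have hmem : (x j : ℂ) ∈ (minpoly ℚ (cmRoot x)).rootSet ℂ := by
    rw [mem_rootSet]
    refine ⟨minpoly.ne_zero (Algebra.IsIntegral.isIntegral _), ?_⟩
    obtain ⟨Q, hQ⟩ := hmin
    rw [hQ, map_mul, show (x j : ℂ) = algebraMap ℝ ℂ (x j) from rfl, aeval_algebraMap_apply,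
      hroot, map_zero, zero_mul]
  rw [← Algebra.IsAlgebraic.range_eval_eq_rootSet_minpoly ℂ (cmRoot x)] at hmem
  obtain ⟨f, hf⟩ := hmem
  have hf' : (f : cmField x →+* ℂ) (cmRoot x) = x j := hf
  have hcases : (f : cmField x →+* ℂ) (cmDisc x) = (-1) ^ (j : ℕ) * (Complex.I * rootDisc x) ∨
      (f : cmField x →+* ℂ) (cmDisc x) = -((-1) ^ (j : ℕ) * (Complex.I * rootDisc x)) := by
    rcases hom_disc_eq hΔ (f : cmField x →+* ℂ) with h | h <;>
      rcases neg_one_pow_eq_or ℂ (j : ℕ) with h' | h' <;> simp [h, h']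
  rcases hcases with h | h
  · exact ⟨f, hf', h⟩
  · refine ⟨(f : cmField x →+* ℂ).comp (cmConj x : cmField x →+* cmField x), ?_, ?_⟩
    · simpa [cmConj_root] using hf'
    · have : (f : cmField x →+* ℂ) (cmConj x (cmDisc x)) = -(f : cmField x →+* ℂ) (cmDisc x) := by
        rw [cmConj_disc, map_neg]
      rw [h, neg_neg] at this
      exact this

theorem isIntegral_cmDisc {Δ : ℤ} (hΔ : rootDisc x ^ 2 = (Δ : ℝ)) : IsIntegral ℤ (cmDisc x) := by
  refine IsIntegral.of_pow (n := 2) (by norm_num) ?_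
  rw [cmDisc_sq hΔ]
  simpa using isIntegral_algebraMap (R := ℤ) (A := cmField x) (x := -Δ)

theorem coords_cmConj {φ : Fin 4 → cmField x →+* ℂ} (h1 : ∀ j, φ j (cmRoot x) = x j)
    (h2 : ∀ j, φ j (cmDisc x) = (-1) ^ (j : ℕ) * (Complex.I * rootDisc x)) (y : cmField x) :
    coords φ (cmConj x y) = conjE (coords φ y) := by
  ext j
  have : (φ j).comp (cmConj x : cmField x →+* cmField x) = (starRingEnd ℂ).comp (φ j) := by
    refine cmField_hom_ext ?_ ?_
    · simp [cmConj_root, h1]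
    · simp [cmConj_disc, h2]
  exact congrArg (fun f => f y) this

theorem conjE_mem_lattice {φ : Fin 4 → cmField x →+* ℂ}
    (h : ∀ y, coords φ (cmConj x y) = conjE (coords φ y)) {l : E} (hl : l ∈ lattice φ) :
    conjE l ∈ lattice φ := by
  obtain ⟨y, rfl⟩ := hl
  refine ⟨NumberField.RingOfIntegers.mapRingEquiv (cmConj x) y, ?_⟩
  exact h _

end Field

end NumberField

/-! ### Pairings of cycles of affine tori -/

section Cycles

variable {K : Type} [Field K] {φ : Fin 4 → K →+* ℂ}

theorem pairing_eq_linearCombination (C : Cycle φ) (ξ : E → E [⋀^Fin 4]→L[ℝ] ℂ) :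
    pairing C ξ = Finsupp.linearCombination ℚ (fun T : SmoothTorus φ => T.integral ξ) C := by
  simp [pairing, Finsupp.linearCombination_apply, Rat.smul_def]

theorem pairing_add (C C' : Cycle φ) (ξ : E → E [⋀^Fin 4]→L[ℝ] ℂ) :
    pairing (C + C') ξ = pairing C ξ + pairing C' ξ := by
  simp only [pairing_eq_linearCombination, map_add]

theorem pairing_sub (C C' : Cycle φ) (ξ : E → E [⋀^Fin 4]→L[ℝ] ℂ) :
    pairing (C - C') ξ = pairing C ξ - pairing C' ξ := by
  simp only [pairing_eq_linearCombination, map_sub]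

theorem pairing_smul (q : ℚ) (C : Cycle φ) (ξ : E → E [⋀^Fin 4]→L[ℝ] ℂ) :
    pairing (q • C) ξ = q * pairing C ξ := by
  simp only [pairing_eq_linearCombination, map_smul, Rat.smul_def]

theorem pairing_sum_single {n : ℕ} (T : Fin n → SmoothTorus φ) (ξ : E → E [⋀^Fin 4]→L[ℝ] ℂ) :
    pairing (∑ k, Finsupp.single (T k) (1 : ℚ)) ξ = ∑ k, (T k).integral ξ := by
  simp [pairing_eq_linearCombination, map_sum]

theorem pairing_pushCycle (α : NumberField.RingOfIntegers K) (C : Cycle φ)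
    (ξ : E → E [⋀^Fin 4]→L[ℝ] ℂ) : pairing (pushCycle φ α C) ξ =
      Finsupp.linearCombination ℚ (fun T : SmoothTorus φ => (T.push α).integral ξ) C := by
  rw [pairing_eq_linearCombination, pushCycle, Finsupp.lmapDomain_apply,
    Finsupp.linearCombination_mapDomain]
  rfl

theorem SmoothTorus.push_frame (α : NumberField.RingOfIntegers K) (T : SmoothTorus φ)
    (t : Fin 4 → ℝ) : (T.push α).frame t = fun i => coords φ (α : K) * T.frame t i := by
  ext1 i
  have h : DifferentiableAt ℝ T.toFun t := (T.smooth.differentiable (by simp)).differentiableAt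
  simp only [SmoothTorus.frame, SmoothTorus.push]
  rw [fderiv_const_mul h]
  rfl

/-- The factor by which `π_α` acts on the integrals of a monomial. -/
noncomputable def monomialChar (φ : Fin 4 → K →+* ℂ) (μ : Fin 4 → Fin 4 ⊕ Fin 4) (α : K) : ℂ :=
  ∏ i, coordForm (μ i) (coords φ α)

theorem pairing_pushCycle_monomial (α : NumberField.RingOfIntegers K) (C : Cycle φ)
    (μ : Fin 4 → Fin 4 ⊕ Fin 4) : pairing (pushCycle φ α C) (fun _ => monomial μ) =
      monomialChar φ μ α * pairing C (fun _ => monomial μ) := by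
  have h : ∀ T : SmoothTorus φ, (T.push α).integral (fun _ => monomial μ) =
      monomialChar φ μ α * T.integral (fun _ => monomial μ) := fun T => by
    simp only [SmoothTorus.integral, SmoothTorus.push_frame, monomial_mul]
    rw [MeasureTheory.integral_const_mul]
    rfl
  rw [pairing_pushCycle, pairing_eq_linearCombination]
  simp only [h, Finsupp.linearCombination_apply, Finsupp.sum, Finset.mul_sum, mul_smul_comm]

theorem pairing_cycleOperator_monomial (Δ : ℤ) (α β : NumberField.RingOfIntegers K) (C : Cycle φ)
    (μ : Fin 4 → Fin 4 ⊕ Fin 4) :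
    pairing (cycleOperator φ Δ α β C) (fun _ => monomial μ) =
      (monomialChar φ μ α - (1 + Δ) ^ 2) * (monomialChar φ μ β + Δ ^ 2) *
        pairing C (fun _ => monomial μ) := by
  simp only [cycleOperator, Module.End.mul_apply, LinearMap.sub_apply, LinearMap.add_apply,
    LinearMap.smul_apply, Module.End.one_apply, pairing_sub, pairing_add, pairing_smul,
    pairing_pushCycle_monomial]
  push_cast
  ring

/-- The affine tori in `X`. -/
def affineTori (φ : Fin 4 → K →+* ℂ) : Set (SmoothTorus φ) :=
  {T | ∃ p v hv, T = affineTorus φ p v hv}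

theorem pairing_const {C : Cycle φ} (hC : C ∈ Finsupp.supported ℚ ℚ (affineTori φ))
    (A : E [⋀^Fin 4]→L[ℝ] ℂ) :
    pairing C (fun _ => A) = C.sum fun T q => (q : ℂ) * A (T.frame 0) := by
  refine Finset.sum_congr rfl fun T hT => ?_
  obtain ⟨p, v, hv, rfl⟩ := (Finsupp.mem_supported _ _).mp hC hT
  simp only [affineTorus_integral_const, affineTorus_frame]

theorem pairing_const_add {C : Cycle φ} (hC : C ∈ Finsupp.supported ℚ ℚ (affineTori φ))
    (A A' : E [⋀^Fin 4]→L[ℝ] ℂ) :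
    pairing C (fun _ => A + A') = pairing C (fun _ => A) + pairing C (fun _ => A') := by
  simp only [pairing_const hC, ContinuousAlternatingMap.add_apply, mul_add, Finsupp.sum_add]

theorem pairing_const_smul {C : Cycle φ} (hC : C ∈ Finsupp.supported ℚ ℚ (affineTori φ))
    (c : ℂ) (A : E [⋀^Fin 4]→L[ℝ] ℂ) :
    pairing C (fun _ => c • A) = c * pairing C (fun _ => A) := by
  simp only [pairing_const hC, ContinuousAlternatingMap.smul_apply, smul_eq_mul, Finsupp.mul_sum]
  refine Finset.sum_congr rfl fun T _ => ?_
  ring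

theorem pairing_const_sub {C : Cycle φ} (hC : C ∈ Finsupp.supported ℚ ℚ (affineTori φ))
    (A A' : E [⋀^Fin 4]→L[ℝ] ℂ) :
    pairing C (fun _ => A - A') = pairing C (fun _ => A) - pairing C (fun _ => A') := by
  rw [sub_eq_add_neg, ← neg_one_smul ℂ A', pairing_const_add hC, pairing_const_smul hC]
  ring

/-! ### Poincaré duality for affine cycles -/

theorem continuous_formCoeff {ξ : E → E [⋀^Fin 4]→L[ℝ] ℂ} (hξ : IsClosedForm φ ξ)
    (μ : Fin 4 → Fin 4 ⊕ Fin 4) : Continuous fun u => formCoeff μ (ξ u) :=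
  continuous_const.mul (continuous_finsetSum _ fun _ _ =>
    continuous_const.mul (contDiff_form_apply hξ _).continuous)

open MeasureTheory in
/-- Both sides of Poincaré duality depend on a closed form only through its average, which is a
combination of monomials. It is therefore enough to test the duality on monomials. -/
theorem represents_of_monomial {B : Module.Basis (Fin 8) ℝ E} (hB : IsLatticeBasis φ B)
    {C : Cycle φ} (hC : C ∈ Finsupp.supported ℚ ℚ (affineTori φ)) (M : E [⋀^Fin 4]→L[ℝ] ℂ)
    (h : ∀ μ : Fin 4 → Fin 4 ⊕ Fin 4, pairing C (fun _ => monomial μ) =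
      (volume.real (ZSpan.fundamentalDomain B) : ℂ) * wedge M (monomial μ) stdFrame) :
    Represents C M := by
  refine ⟨B, hB, fun ξ hξ => ?_⟩
  have hint : ∀ μ, Integrable (fun u => formCoeff μ (ξ u))
      (volume.restrict (ZSpan.fundamentalDomain B)) := fun μ => by
    have := (continuous_formCoeff hξ μ).continuousOn.integrableOn_compact (μ := volume)
      (ZSpan.fundamentalDomain_isBounded B).isCompact_closure
    exact this.mono_set subset_closure
  set a : (Fin 4 → Fin 4 ⊕ Fin 4) → ℂ := fun μ =>
    ∫ u in ZSpan.fundamentalDomain B, formCoeff μ (ξ u) with ha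
  have hvol : (volume.real (ZSpan.fundamentalDomain B) : ℂ) ≠ 0 := by
    rw [Ne, Complex.ofReal_eq_zero, measureReal_def, ENNReal.toReal_eq_zero_iff, not_or]
    exact ⟨ZSpan.measure_fundamentalDomain_ne_zero B,
      (ZSpan.fundamentalDomain_isBounded B).measure_lt_top.ne⟩
  have hright : ∫ u in ZSpan.fundamentalDomain B, wedge M (ξ u) stdFrame =
      ∑ μ, a μ * wedge M (monomial μ) stdFrame := by
    simp only [wedge_eq_sum_monomial M (ξ _), ha]
    rw [integral_finsetSum _ fun μ _ => (hint μ).mul_const _]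
    simp only [integral_mul_const]
  have htorus : ∀ T ∈ affineTori φ, (volume.real (ZSpan.fundamentalDomain B) : ℂ) *
      T.integral ξ = ∑ μ, a μ * T.integral (fun _ => monomial μ) := by
    rintro _ ⟨p, v, hv, rfl⟩
    rw [affineTorus_integral, integral_affine_mul_volume hB hξ p v hv]
    simp only [affineTorus_integral_const, ha]
    simp_rw [eq_sum_monomial (ξ _) v]
    rw [integral_finsetSum _ fun μ _ => (hint μ).mul_const _]
    simp only [integral_mul_const]
  have hleft : (volume.real (ZSpan.fundamentalDomain B) : ℂ) * pairing C ξ =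
      ∑ μ, a μ * pairing C (fun _ => monomial μ) := by
    simp only [pairing, Finsupp.sum, Finset.mul_sum]
    rw [Finset.sum_comm]
    refine Finset.sum_congr rfl fun T hT => ?_
    rw [mul_left_comm, htorus T ((Finsupp.mem_supported _ _).mp hC hT), Finset.mul_sum]
    refine Finset.sum_congr rfl fun μ _ => ?_
    ring
  apply mul_left_cancel₀ hvol
  rw [hleft, hright, Finset.mul_sum]
  refine Finset.sum_congr rfl fun μ _ => ?_
  rw [h]
  ring

/-- The duality with a combination of the two distinguished monomials has to be tested only on
these two. -/
theorem represents_of_etaIdx {B : Module.Basis (Fin 8) ℝ E} (hB : IsLatticeBasis φ B)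
    {C : Cycle φ} (hC : C ∈ Finsupp.supported ℚ ℚ (affineTori φ)) (hM : PairsOnlyWithM C) (c c' : ℂ)
    (h : pairing C (fun _ => monomial etaIdx) =
      (MeasureTheory.volume.real (ZSpan.fundamentalDomain B) : ℂ) * (c' * 16))
    (h' : pairing C (fun _ => monomial etaBarIdx) =
      (MeasureTheory.volume.real (ZSpan.fundamentalDomain B) : ℂ) * (c * 16)) :
    Represents C (c • monomial etaIdx + c' • monomial etaBarIdx) := by
  have hinj : Function.Injective (Sum.elim etaIdx etaBarIdx) := by decide
  have hinj' : Function.Injective (Sum.elim etaBarIdx etaIdx) := by decide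
  have hne : Set.range etaIdx ≠ Set.range etaBarIdx := fun heq => by
    obtain ⟨i, hi⟩ : etaIdx 0 ∈ Set.range etaBarIdx := heq ▸ Set.mem_range_self 0
    revert hi
    revert i
    decide
  have hzero : ∀ μ, Set.range μ ≠ Set.range etaBarIdx →
      wedge (monomial etaIdx) (monomial μ) stdFrame = 0 := fun μ hμ =>
    wedge_monomial_eq_zero _ _ (fun hi => hμ (range_eq_of_injective_elim hi hinj)) _
  have hzero' : ∀ μ, Set.range μ ≠ Set.range etaIdx →
      wedge (monomial etaBarIdx) (monomial μ) stdFrame = 0 := fun μ hμ =>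
    wedge_monomial_eq_zero _ _ (fun hi => hμ (range_eq_of_injective_elim hi hinj')) _
  refine represents_of_monomial hB hC _ fun μ => ?_
  rw [wedge_add_left, wedge_smul_left, wedge_smul_left]
  by_cases h1 : Set.range μ = Set.range etaIdx
  · obtain ⟨τ, rfl⟩ := exists_perm_of_range_eq etaIdx_injective h1
    rw [hzero _ (h1 ▸ hne), monomial_comp_perm, pairing_const_smul hC, h, wedge_smul_right,
      wedge_etaBar_eta]
    ring
  · rw [hzero' _ h1]
    by_cases h2 : Set.range μ = Set.range etaBarIdx
    · obtain ⟨τ, rfl⟩ := exists_perm_of_range_eq etaBarIdx_injective h2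
      rw [monomial_comp_perm, pairing_const_smul hC, h', wedge_smul_right, wedge_eta_etaBar]
      ring
    · rw [hzero _ h2, hM μ h1 h2]
      ring

/-! ### Calibrated cycles with complex multiplication -/

/-- All `|φ_j(α)|²` are equal to one number `N`, and `∏ φ_j(α) = N²`. Then multiplication by `α`
scales the metric by `N` and `θ` by `N²`, so that it maps calibrated frames parallel to `ℝ⁴` to
calibrated frames. -/
def PreservesCalibration (φ : Fin 4 → K →+* ℂ) (α : K) : Prop :=
  ∃ N : ℝ, 0 < N ∧ (∀ j, φ j α * (starRingEnd ℂ) (φ j α) = N) ∧ ∏ j, φ j α = (N : ℂ) ^ 2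

theorem PreservesCalibration.mul {α α' : K} (h : PreservesCalibration φ α)
    (h' : PreservesCalibration φ α') : PreservesCalibration φ (α * α') := by
  obtain ⟨N, hN, h1, h2⟩ := h
  obtain ⟨N', hN', h1', h2'⟩ := h'
  refine ⟨N * N', mul_pos hN hN', fun j => ?_, ?_⟩
  · push_cast
    rw [← h1 j, ← h1' j]
    simp only [map_mul]
    ring
  · simp only [map_mul, Finset.prod_mul_distrib, h2, h2']
    push_cast
    ring

theorem PreservesCalibration.one : PreservesCalibration φ (1 : K) :=
  ⟨1, one_pos, fun j => by simp, by simp⟩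

/-- The affine tori parallel to `α ℝ⁴` with frame `α b₁, …, α b₄`, for a positively oriented frame
`b` of `ℝ⁴` and an integer `α` that preserves the calibrations. -/
def calibratedTori (φ : Fin 4 → K →+* ℂ) (b : Fin 4 → Fin 4 → ℝ) : Set (SmoothTorus φ) :=
  {T | ∃ (α : NumberField.RingOfIntegers K) (p : E) (hv : _), PreservesCalibration φ (α : K) ∧
    T = affineTorus φ p (fun i => coords φ (α : K) * realPt (b i)) hv}

theorem calibratedTori_subset (b : Fin 4 → Fin 4 → ℝ) : calibratedTori φ b ⊆ affineTori φ := by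
  rintro _ ⟨α, p, hv, -, rfl⟩
  exact ⟨p, _, hv, rfl⟩

theorem push_mem_calibratedTori {b : Fin 4 → Fin 4 → ℝ} {α : NumberField.RingOfIntegers K}
    (hα : PreservesCalibration φ (α : K)) {T : SmoothTorus φ} (hT : T ∈ calibratedTori φ b) :
    T.push α ∈ calibratedTori φ b := by
  obtain ⟨α', p, hv, h, rfl⟩ := hT
  have heq : (fun i => coords φ ((α * α' : NumberField.RingOfIntegers K) : K) * realPt (b i)) =
      fun i => coords φ (α : K) * (coords φ (α' : K) * realPt (b i)) := by
    ext i j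
    simp [coords, mul_assoc]
  refine ⟨α * α', coords φ (α : K) * p, ?_, by simpa using hα.mul h, ?_⟩
  · intro i
    rw [congrFun heq i]
    exact mul_mem_lattice α (hv i)
  · rw [affineTorus_push]
    congr 1
    exact heq.symm

theorem cycleOperator_mem_supported {b : Fin 4 → Fin 4 → ℝ} {α β : NumberField.RingOfIntegers K}
    (hα : PreservesCalibration φ (α : K)) (hβ : PreservesCalibration φ (β : K)) (Δ : ℤ)
    {C : Cycle φ} (hC : C ∈ Finsupp.supported ℚ ℚ (calibratedTori φ b)) :
    cycleOperator φ Δ α β C ∈ Finsupp.supported ℚ ℚ (calibratedTori φ b) := by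
  classical
  have hpush : ∀ {α : NumberField.RingOfIntegers K}, PreservesCalibration φ (α : K) →
      ∀ {C : Cycle φ}, C ∈ Finsupp.supported ℚ ℚ (calibratedTori φ b) →
        pushCycle φ α C ∈ Finsupp.supported ℚ ℚ (calibratedTori φ b) := fun {α} hα {C} hC => by
    rw [Finsupp.mem_supported] at hC ⊢
    intro T hT
    obtain ⟨T', hT', rfl⟩ := Finset.mem_image.mp (Finsupp.mapDomain_support hT)
    exact push_mem_calibratedTori hα (hC hT')
  simp only [cycleOperator, Module.End.mul_apply, LinearMap.sub_apply, LinearMap.add_apply,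
    LinearMap.smul_apply, Module.End.one_apply]
  have h1 := add_mem (hpush hβ hC) (Submodule.smul_mem _ ((Δ : ℚ) ^ 2) hC)
  exact sub_mem (hpush hα h1) (Submodule.smul_mem _ _ h1)

theorem isSLCayleyCycle_of_mem_supported {x : Fin 4 → ℝ} (hx : StrictAnti x)
    {b : Fin 4 → Fin 4 → ℝ} (hb : 0 < (Matrix.of b).det) {C : Cycle φ}
    (hC : C ∈ Finsupp.supported ℚ ℚ (calibratedTori φ b)) : IsSLCayleyCycle x C := by
  intro T hT
  obtain ⟨α, p, hv, ⟨N, hN, h1, h2⟩, rfl⟩ := (Finsupp.mem_supported _ _).mp hC hT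
  constructor <;> intro t <;> rw [affineTorus_frame]
  · exact isCalibratedFrame_slForm hx hN h1 h2 hb
  · exact isCalibratedFrame_cayleyForm hx hN h1 h2 hb

end Cycles

/-! ### The characters of `i𝔻` on monomials -/

/-- The sign `ε` for which the conjugate of `i𝔻` attached to a coordinate form is `ε i𝔻`. -/
def formSign : Fin 4 ⊕ Fin 4 → ℤ
  | .inl j => (-1) ^ (j : ℕ)
  | .inr j => -(-1) ^ (j : ℕ)

theorem formSign_eq_or (a : Fin 4 ⊕ Fin 4) : formSign a = 1 ∨ formSign a = -1 := by
  revert a; decide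

theorem formSign_eq_one_iff (a : Fin 4 ⊕ Fin 4) : formSign a = 1 ↔ a ∈ Set.range etaIdx := by
  simp only [Set.mem_range]; revert a; decide

theorem formSign_eq_neg_one_iff (a : Fin 4 ⊕ Fin 4) :
    formSign a = -1 ↔ a ∈ Set.range etaBarIdx := by
  simp only [Set.mem_range]; revert a; decide

theorem range_eq_of_subset {μ ν : Fin 4 → Fin 4 ⊕ Fin 4} (hμ : Function.Injective μ)
    (h : ∀ i, μ i ∈ Set.range ν) : Set.range μ = Set.range ν := by
  refine Set.eq_of_subset_of_ncard_le (Set.range_subset_iff.mpr h) ?_ (Set.finite_range ν)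
  rw [← Set.image_univ, ← Set.image_univ, Set.ncard_image_of_injective _ hμ]
  exact Set.ncard_image_le Set.finite_univ

section Char

variable {K : Type} [Field K] {φ : Fin 4 → K →+* ℂ} {x : Fin 4 → ℝ} {β : K}

theorem coordForm_coords_disc (h : ∀ j, φ j β = (-1) ^ (j : ℕ) * (Complex.I * rootDisc x))
    (a : Fin 4 ⊕ Fin 4) :
    coordForm a (coords φ β) = formSign a * (Complex.I * rootDisc x) := by
  rcases a with j | j
  · simp [coordForm, coords, h, formSign]
  · simp [coordForm, coords, h, formSign]

theorem coordForm_coords_add (a : Fin 4 ⊕ Fin 4) (y z : K) :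
    coordForm a (coords φ (y + z)) = coordForm a (coords φ y) + coordForm a (coords φ z) := by
  rw [← map_add]
  congr 1
  ext j
  simp [coords]

theorem coordForm_coords_one (a : Fin 4 ⊕ Fin 4) : coordForm a (coords φ (1 : K)) = 1 := by
  rcases a with j | j <;> simp [coordForm, coords]

theorem coordForm_coords_neg (a : Fin 4 ⊕ Fin 4) (y : K) :
    coordForm a (coords φ (-y)) = -coordForm a (coords φ y) := by
  rw [← map_neg]
  congr 1
  ext j
  simp [coords]

theorem monomialChar_disc (h : ∀ j, φ j β = (-1) ^ (j : ℕ) * (Complex.I * rootDisc x))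
    (μ : Fin 4 → Fin 4 ⊕ Fin 4) :
    monomialChar φ μ β = ∏ i, (formSign (μ i) * (Complex.I * rootDisc x)) := by
  simp only [monomialChar, coordForm_coords_disc h]

theorem monomialChar_one_add (h : ∀ j, φ j β = (-1) ^ (j : ℕ) * (Complex.I * rootDisc x))
    (μ : Fin 4 → Fin 4 ⊕ Fin 4) :
    monomialChar φ μ (1 + β) = ∏ i, (1 + formSign (μ i) * (Complex.I * rootDisc x)) := by
  simp only [monomialChar, coordForm_coords_add, coordForm_coords_one, coordForm_coords_disc h]

theorem monomialChar_one_sub (h : ∀ j, φ j β = (-1) ^ (j : ℕ) * (Complex.I * rootDisc x))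
    (μ : Fin 4 → Fin 4 ⊕ Fin 4) :
    monomialChar φ μ (1 - β) = ∏ i, (1 - formSign (μ i) * (Complex.I * rootDisc x)) := by
  simp only [sub_eq_add_neg, monomialChar, coordForm_coords_add, coordForm_coords_one,
    coordForm_coords_neg, coordForm_coords_disc h]

/-- In terms of `z = i𝔻` one has `Δ = -z²`. -/
theorem intCast_eq_neg_sq {Δ : ℤ} (hΔ : rootDisc x ^ 2 = (Δ : ℝ)) :
    (Δ : ℂ) = -(Complex.I * rootDisc x) ^ 2 := by
  have h : (rootDisc x : ℂ) ^ 2 = Δ := by exact_mod_cast hΔ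
  rw [mul_pow, Complex.I_sq, h]
  ring

/-- With `p` plus signs among the four conjugates of `i𝔻`, the second factor of the operator
vanishes when `p` is odd and the first one when `p = 2`. Both survive only when all signs agree. -/
theorem operator_factor_eq_zero (z : ℂ) {s : Fin 4 → ℤ} (hs : ∀ i, s i = 1 ∨ s i = -1)
    (h1 : ¬ ∀ i, s i = 1) (h2 : ¬ ∀ i, s i = -1) :
    (∏ i, (1 + s i * z) - (1 + -z ^ 2) ^ 2) * (∏ i, (s i * z) + (-z ^ 2) ^ 2) = 0 := by
  simp only [Fin.prod_univ_four]
  rcases hs 0 with a0 | a0 <;> rcases hs 1 with a1 | a1 <;> rcases hs 2 with a2 | a2 <;>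
    rcases hs 3 with a3 | a3 <;> first
      | (rw [a0, a1, a2, a3]; push_cast; ring1)
      | (refine absurd (fun i => ?_) h1; fin_cases i <;> assumption)
      | (refine absurd (fun i => ?_) h2; fin_cases i <;> assumption)

theorem pairsOnlyWithM_cycleOperator {Δ : ℤ} {α β : NumberField.RingOfIntegers K} {z : ℂ}
    (hz : (Δ : ℂ) = -z ^ 2)
    (hα : ∀ μ, monomialChar φ μ (α : K) = ∏ i, (1 + formSign (μ i) * z))
    (hβ : ∀ μ, monomialChar φ μ (β : K) = ∏ i, (formSign (μ i) * z)) {C : Cycle φ}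
    (hC : ∀ μ : Fin 4 → Fin 4 ⊕ Fin 4, ¬ Function.Injective μ →
      pairing C (fun _ => monomial μ) = 0) : PairsOnlyWithM (cycleOperator φ Δ α β C) := by
  intro μ h1 h2
  rw [pairing_cycleOperator_monomial, hα, hβ, hz]
  by_cases hμ : Function.Injective μ
  · rw [operator_factor_eq_zero z (fun i => formSign_eq_or (μ i)) ?_ ?_, zero_mul]
    · exact fun h => h1 (range_eq_of_subset hμ fun i => (formSign_eq_one_iff _).mp (h i))
    · exact fun h => h2 (range_eq_of_subset hμ fun i => (formSign_eq_neg_one_iff _).mp (h i))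
  · rw [hC μ hμ, mul_zero]

/-- With `Δ = -z²` the two factors are `(1 + z)⁴ - (1 - z²)² = 4z(1 + z)²` and `2z⁴`. -/
theorem pairing_cycleOperator_etaIdx {Δ : ℤ} {α β : NumberField.RingOfIntegers K} {z : ℂ}
    (hz : (Δ : ℂ) = -z ^ 2)
    (hα : ∀ μ, monomialChar φ μ (α : K) = ∏ i, (1 + formSign (μ i) * z))
    (hβ : ∀ μ, monomialChar φ μ (β : K) = ∏ i, (formSign (μ i) * z)) (C : Cycle φ) :
    pairing (cycleOperator φ Δ α β C) (fun _ => monomial etaIdx) =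
      8 * z ^ 5 * (1 + z) ^ 2 * pairing C (fun _ => monomial etaIdx) := by
  have h : ∀ i, formSign (etaIdx i) = 1 := by decide
  rw [pairing_cycleOperator_monomial, hα, hβ, hz]
  simp only [h, Fin.prod_univ_four]
  push_cast
  ring

theorem pairing_cycleOperator_etaBarIdx {Δ : ℤ} {α β : NumberField.RingOfIntegers K} {z : ℂ}
    (hz : (Δ : ℂ) = -z ^ 2)
    (hα : ∀ μ, monomialChar φ μ (α : K) = ∏ i, (1 + formSign (μ i) * z))
    (hβ : ∀ μ, monomialChar φ μ (β : K) = ∏ i, (formSign (μ i) * z)) (C : Cycle φ) :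
    pairing (cycleOperator φ Δ α β C) (fun _ => monomial etaBarIdx) =
      -8 * z ^ 5 * (1 - z) ^ 2 * pairing C (fun _ => monomial etaBarIdx) := by
  have h : ∀ i, formSign (etaBarIdx i) = -1 := by decide
  rw [pairing_cycleOperator_monomial, hα, hβ, hz]
  simp only [h, Fin.prod_univ_four]
  push_cast
  ring

theorem preservesCalibration_disc (hx : StrictAnti x)
    (h : ∀ j, φ j β = (-1) ^ (j : ℕ) * (Complex.I * rootDisc x)) : PreservesCalibration φ β := by
  refine ⟨rootDisc x ^ 2, pow_pos (rootDisc_pos hx) 2, fun j => ?_, ?_⟩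
  · rw [h]
    rcases neg_one_pow_eq_or ℂ (j : ℕ) with h' | h' <;> rw [h'] <;> simp <;>
      linear_combination -(rootDisc x : ℂ) ^ 2 * Complex.I_sq
  · simp only [Fin.prod_univ_four, h]
    simp
    linear_combination (rootDisc x : ℂ) ^ 4 * (Complex.I ^ 2 - 1) * Complex.I_sq

theorem preservesCalibration_one_add {α : K} {d : ℝ}
    (h : ∀ j, φ j α = 1 + (-1) ^ (j : ℕ) * (Complex.I * d)) : PreservesCalibration φ α := by
  refine ⟨1 + d ^ 2, by positivity, fun j => ?_, ?_⟩
  · rw [h]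
    rcases neg_one_pow_eq_or ℂ (j : ℕ) with h' | h' <;> rw [h'] <;> simp <;>
      linear_combination -(d : ℂ) ^ 2 * Complex.I_sq
  · simp only [Fin.prod_univ_four, h]
    simp
    linear_combination
      ((d : ℂ) ^ 4 * (Complex.I ^ 2 - 1) - 2 * (d : ℂ) ^ 2) * Complex.I_sq

end Char

/-- The geometric part of the theorem, for any number field of degree at most eight with embeddings
and generators as prescribed. All that is used of the polynomial is contained in these and in
`Δ ≠ 1`. -/
theorem exists_cycles {K : Type} [Field K] [NumberField K] {φ : Fin 4 → K →+* ℂ} {x : Fin 4 → ℝ}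
    {ξ : K} {β : NumberField.RingOfIntegers K} (h : IsCMGenerators φ x ξ (β : K)) {Δ : ℤ}
    (hΔ : rootDisc x ^ 2 = (Δ : ℝ)) (hΔ1 : Δ ≠ 1)
    (hconj : ∀ l ∈ lattice φ, conjE l ∈ lattice φ) :
    (Function.fixedPoints (conjTorus hconj)).Nonempty ∧
      IsCompact (Function.fixedPoints (conjTorus hconj)) ∧
      IsCalibratedSubmanifold φ (kahlerMetric x) (slForm x)
        (Function.fixedPoints (conjTorus hconj)) ∧
      IsCalibratedSubmanifold φ (kahlerMetric x) (cayleyForm x)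
        (Function.fixedPoints (conjTorus hconj)) ∧
      ∃ (n : ℕ) (T : Fin n → SmoothTorus φ),
        Parametrizes T (Function.fixedPoints (conjTorus hconj)) ∧
        IsSLCayleyCycle x (∑ k, Finsupp.single (T k) (1 : ℚ)) ∧
      ∃ Y Ca Ca' : Cycle φ,
        Y = ∑ k, Finsupp.single (T k) (1 : ℚ) ∧
        Ca = cycleOperator φ Δ (1 + β) β Y ∧
        Ca' = cycleOperator φ Δ (1 - β) β Y ∧
        IsSLCayleyCycle x Ca ∧ IsSLCayleyCycle x Ca' ∧
        PairsOnlyWithM Ca ∧ PairsOnlyWithM Ca' ∧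
        (Matrix.of ![![pairing Ca (fun _ => classM x), pairing Ca (fun _ => classM')],
          ![pairing Ca' (fun _ => classM x), pairing Ca' (fun _ => classM')]]).det ≠ 0 ∧
        (∃ r s : ℚ, Represents (r • Ca + s • Ca') (classM x)) ∧
        (∃ r s : ℚ, Represents (r • Ca + s • Ca') classM') := by
  have hD := rootDisc_pos h.anti
  obtain ⟨B, hB, q, hq⟩ := h.exists_isLatticeBasis hΔ
  obtain ⟨b, hdet, ⟨q', hq'⟩, hb, hgen⟩ := h.exists_realLatticeBasis hB hconj
  obtain ⟨n, p, hn, hT⟩ := exists_parametrizes_fixedPoints hB hconj b hb hgen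
  set T : Fin n → SmoothTorus φ := fun k => affineTorus φ (p k) (fun i => realPt (b i)) hb with hTdef
  -- the standard frame of `ℝ⁴` is calibrated, which makes the fixed locus calibrated
  have hone : (fun i : Fin 4 => realPt (Pi.single i 1)) =
      fun i : Fin 4 => (1 : E) * realPt (Pi.single i 1) := by simp
  have hdet1 : 0 < (Matrix.of fun i : Fin 4 => (Pi.single i 1 : Fin 4 → ℝ)).det := by
    have : (Matrix.of fun i : Fin 4 => (Pi.single i 1 : Fin 4 → ℝ)) = 1 := by
      ext i j
      simp [Matrix.one_apply, Pi.single_apply, eq_comm]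
    rw [this, Matrix.det_one]
    exact one_pos
  refine ⟨⟨proj φ 0, (proj_mem_fixedPoints_iff hconj).mpr (by simp)⟩, ?_,
    isCalibratedSubmanifold_fixedPoints hB hconj (hone ▸
      isCalibratedFrame_slForm h.anti one_pos (by simp) (by simp) hdet1),
    isCalibratedSubmanifold_fixedPoints hB hconj (hone ▸
      isCalibratedFrame_cayleyForm h.anti one_pos (by simp) (by simp) hdet1), n, T, hT, ?_⟩
  · rw [← hT.2.2]
    exact isCompact_iUnion fun k => (T k).isCompact_image
  set Y : Cycle φ := ∑ k, Finsupp.single (T k) (1 : ℚ) with hY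
  have hYmem : Y ∈ Finsupp.supported ℚ ℚ (calibratedTori φ b) := by
    refine sum_mem fun k _ => Finsupp.single_mem_supported ℚ _ ?_
    have hc : coords φ ((1 : NumberField.RingOfIntegers K) : K) = 1 := by
      ext j; simp [coords]
    have heq : (fun i => realPt (b i)) =
        fun i => coords φ ((1 : NumberField.RingOfIntegers K) : K) * realPt (b i) := by
      rw [hc]
      simp only [one_mul]
    refine ⟨1, p k, fun i => congrFun heq i ▸ hb i, by simpa using PreservesCalibration.one, ?_⟩
    simp only [hTdef]
    congr 1
  refine ⟨isSLCayleyCycle_of_mem_supported h.anti hdet hYmem, ?_⟩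
  -- the characters of `1 + β`, `1 - β` and `β`
  set z : ℂ := Complex.I * rootDisc x with hz
  have hzΔ : (Δ : ℂ) = -z ^ 2 := intCast_eq_neg_sq hΔ
  have hzΔ' : (Δ : ℂ) = -(-z) ^ 2 := by rw [hzΔ]; ring
  have hα : ∀ μ, monomialChar φ μ ((1 + β : NumberField.RingOfIntegers K) : K) =
      ∏ i, (1 + formSign (μ i) * z) := fun μ => by
    simpa using monomialChar_one_add h.map_disc μ
  have hα' : ∀ μ, monomialChar φ μ ((1 - β : NumberField.RingOfIntegers K) : K) =
      ∏ i, (1 + formSign (μ i) * -z) := fun μ => by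
    simpa [sub_eq_add_neg] using monomialChar_one_sub h.map_disc μ
  have hβ : ∀ μ, monomialChar φ μ (β : K) = ∏ i, (formSign (μ i) * z) :=
    monomialChar_disc h.map_disc
  have hβ' : ∀ μ, monomialChar φ μ (β : K) = ∏ i, (formSign (μ i) * -z) := fun μ => by
    rw [hβ]
    simp only [Fin.prod_univ_four]
    ring
  -- the periods of the fixed cycle
  have hYconst : ∀ μ, pairing Y (fun _ => monomial μ) =
      n * monomial μ (fun i => realPt (b i)) := fun μ => by
    rw [hY, pairing_sum_single]
    simp [hTdef, affineTorus_integral_const]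
  have hYzero : ∀ μ : Fin 4 → Fin 4 ⊕ Fin 4, ¬ Function.Injective μ →
      pairing Y (fun _ => monomial μ) = 0 := fun μ hμ => by
    rw [hYconst, monomial_realPt_eq_zero μ (fun h => hμ h.of_comp), mul_zero]
  set V : ℂ := n * (q' * rootDisc x) with hV
  have hdetV : (((Matrix.of b).det : ℝ) : ℂ) = q' * rootDisc x := by rw [hq']; push_cast; rfl
  have hYeta : pairing Y (fun _ => monomial etaIdx) = V := by
    rw [hYconst, monomial_realPt _ formIndex_etaIdx, hdetV]
  have hYetaBar : pairing Y (fun _ => monomial etaBarIdx) = V := by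
    rw [hYconst, monomial_realPt _ formIndex_etaBarIdx, hdetV]
  have hDne : (rootDisc x : ℂ) ≠ 0 := by exact_mod_cast hD.ne'
  have hnne : (n : ℂ) ≠ 0 := by exact_mod_cast hn
  have hqne : (q' : ℂ) ≠ 0 := fun h0 => by
    rw [h0, zero_mul] at hdetV
    exact hdet.ne' (by exact_mod_cast hdetV)
  have hVne : V ≠ 0 := mul_ne_zero hnne (mul_ne_zero hqne hDne)
  have hzne : z ≠ 0 := mul_ne_zero Complex.I_ne_zero hDne
  have hz1 : 1 + z ^ 2 ≠ 0 := fun h0 => hΔ1 (by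
    have : (Δ : ℂ) = 1 := by rw [hzΔ]; linear_combination -h0
    exact_mod_cast this)
  set Ca := cycleOperator φ Δ (1 + β) β Y with hCa
  set Ca' := cycleOperator φ Δ (1 - β) β Y with hCa'
  have hCal : PreservesCalibration φ ((1 + β : NumberField.RingOfIntegers K) : K) :=
    preservesCalibration_one_add (d := rootDisc x) fun j => by simp [h.map_disc]
  have hCal' : PreservesCalibration φ ((1 - β : NumberField.RingOfIntegers K) : K) :=
    preservesCalibration_one_add (d := -rootDisc x) fun j => by
      simp [h.map_disc, sub_eq_add_neg]
  have hCalβ := preservesCalibration_disc h.anti h.map_disc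
  have hCmem : Ca ∈ Finsupp.supported ℚ ℚ (calibratedTori φ b) :=
    cycleOperator_mem_supported hCal hCalβ Δ hYmem
  have hCmem' : Ca' ∈ Finsupp.supported ℚ ℚ (calibratedTori φ b) :=
    cycleOperator_mem_supported hCal' hCalβ Δ hYmem
  have hsub := Finsupp.supported_mono (M := ℚ) (R := ℚ) (calibratedTori_subset (φ := φ) b)
  have hP : PairsOnlyWithM Ca := pairsOnlyWithM_cycleOperator hzΔ hα hβ hYzero
  have hP' : PairsOnlyWithM Ca' := pairsOnlyWithM_cycleOperator hzΔ' hα' hβ' hYzero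
  have e1 : pairing Ca (fun _ => monomial etaIdx) = 8 * z ^ 5 * (1 + z) ^ 2 * V := by
    rw [hCa, pairing_cycleOperator_etaIdx hzΔ hα hβ, hYeta]
  have e2 : pairing Ca (fun _ => monomial etaBarIdx) = -8 * z ^ 5 * (1 - z) ^ 2 * V := by
    rw [hCa, pairing_cycleOperator_etaBarIdx hzΔ hα hβ, hYetaBar]
  have e3 : pairing Ca' (fun _ => monomial etaIdx) = -8 * z ^ 5 * (1 - z) ^ 2 * V := by
    rw [hCa', pairing_cycleOperator_etaIdx hzΔ' hα' hβ', hYeta]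
    ring
  have e4 : pairing Ca' (fun _ => monomial etaBarIdx) = 8 * z ^ 5 * (1 + z) ^ 2 * V := by
    rw [hCa', pairing_cycleOperator_etaBarIdx hzΔ' hα' hβ', hYetaBar]
    ring
  have hcomb : ∀ r s : ℚ, r • Ca + s • Ca' ∈ Finsupp.supported ℚ ℚ (affineTori φ) := fun r s =>
    hsub (add_mem (Submodule.smul_mem _ _ hCmem) (Submodule.smul_mem _ _ hCmem'))
  have hcombP : ∀ r s : ℚ, PairsOnlyWithM (r • Ca + s • Ca') := fun r s μ h1 h2 => by
    rw [pairing_add, pairing_smul, pairing_smul, hP μ h1 h2, hP' μ h1 h2]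
    ring
  refine ⟨Y, Ca, Ca', rfl, rfl, rfl, isSLCayleyCycle_of_mem_supported h.anti hdet hCmem,
    isSLCayleyCycle_of_mem_supported h.anti hdet hCmem', hP, hP', ?_, ?_, ?_⟩
  · have hM : ∀ {C : Cycle φ}, C ∈ Finsupp.supported ℚ ℚ (calibratedTori φ b) →
        pairing C (fun _ => classM x) = rootDisc x * (pairing C (fun _ => monomial etaIdx) +
          pairing C (fun _ => monomial etaBarIdx)) := fun hC => by
      rw [classM, pairing_const_smul (hsub hC), pairing_const_add (hsub hC)]
    have hM' : ∀ {C : Cycle φ}, C ∈ Finsupp.supported ℚ ℚ (calibratedTori φ b) →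
        pairing C (fun _ => classM') = Complex.I * (pairing C (fun _ => monomial etaIdx) -
          pairing C (fun _ => monomial etaBarIdx)) := fun hC => by
      rw [classM', pairing_const_smul (hsub hC), pairing_const_sub (hsub hC)]
    rw [Matrix.det_fin_two]
    simp only [Matrix.of_apply, Matrix.cons_val_zero, Matrix.cons_val_one, hM hCmem, hM hCmem',
      hM' hCmem, hM' hCmem', e1, e2, e3, e4]
    -- with `u` and `v` the two periods of `Ca`, the determinant is `-2i𝔻(u + v)(u - v)`
    have : (rootDisc x : ℂ) * (Complex.I * (z ^ 11 * (V ^ 2 * (1 + z ^ 2)))) * (-1024) ≠ 0 := by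
      refine mul_ne_zero (mul_ne_zero hDne (mul_ne_zero Complex.I_ne_zero
        (mul_ne_zero (pow_ne_zero _ hzne) (mul_ne_zero (pow_ne_zero _ hVne) hz1)))) (by norm_num)
    convert! this using 1
    ring
  -- the coefficients solve the two equations of `represents_of_etaIdx`
  · refine ⟨-q / (2 * Δ ^ 3 * n * q'), -q / (2 * Δ ^ 3 * n * q'), ?_⟩
    rw [classM, smul_add]
    refine represents_of_etaIdx hB (hcomb _ _) (hcombP _ _) _ _ ?_ ?_
    · rw [pairing_add, pairing_smul, pairing_smul, e1, e3, hq]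
      push_cast
      rw [hzΔ, hV]
      field_simp
      ring
    · rw [pairing_add, pairing_smul, pairing_smul, e2, e4, hq]
      push_cast
      rw [hzΔ, hV]
      field_simp
      ring
  · refine ⟨-q / (n * q' * Δ ^ 3 * (1 - Δ)), q / (n * q' * Δ ^ 3 * (1 - Δ)), ?_⟩
    have hDz : (rootDisc x : ℂ) = -Complex.I * z := by
      linear_combination (rootDisc x : ℂ) * Complex.I_sq
    have hM' : classM' = Complex.I • monomial etaIdx + (-Complex.I) • monomial etaBarIdx := by
      ext v
      simp only [classM', ContinuousAlternatingMap.smul_apply, ContinuousAlternatingMap.sub_apply,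
        ContinuousAlternatingMap.add_apply, smul_eq_mul]
      ring
    rw [hM']
    refine represents_of_etaIdx hB (hcomb _ _) (hcombP _ _) _ _ ?_ ?_
    · rw [pairing_add, pairing_smul, pairing_smul, e1, e3, hq]
      push_cast
      rw [hzΔ, hV, hDz, sub_neg_eq_add]
      field_simp
      ring
    · rw [pairing_add, pairing_smul, pairing_smul, e2, e4, hq]
      push_cast
      rw [hzΔ, hV, hDz, sub_neg_eq_add]
      field_simp
      ring

end CayleyCycles

open CayleyCycles Polynomial in
theorem mainTheorem3 (a b c d : ℚ) (P : ℚ[X])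
    (hP : P = C a * Polynomial.X ^ 4 + C b * Polynomial.X ^ 2 + C c * Polynomial.X + C d)
    (hirr : Irreducible P) (hGal : Nonempty (P.Gal ≃* Equiv.Perm (Fin 4)))
    (x : Fin 4 → ℝ) (hx : StrictAnti x) (hroot : ∀ j, aeval (x j) P = 0)
    (Δ : ℤ) (hΔ : rootDisc x ^ 2 = (Δ : ℝ)) :
    ∃ φ : Fin 4 → cmField x →+* ℂ, IsLabelling x φ ∧
      -- the involution induced by complex conjugation on the field
      ∃ κ : cmField x ≃+* cmField x,
        (∀ y : cmField x, ((κ y : cmField x) : ℂ) = (starRingEnd ℂ) (y : ℂ)) ∧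
        (∀ y : cmField x, coords φ (κ y) = conjE (coords φ y)) ∧
      ∃ σ : CMTorus φ → CMTorus φ,
        (∀ u : E, σ (proj φ u) = proj φ (conjE u)) ∧
        -- its fixed locus is a compact special Lagrangian submanifold
        (Function.fixedPoints σ).Nonempty ∧ IsCompact (Function.fixedPoints σ) ∧
        IsCalibratedSubmanifold φ (kahlerMetric x) (slForm x) (Function.fixedPoints σ) ∧
        IsCalibratedSubmanifold φ (kahlerMetric x) (cayleyForm x) (Function.fixedPoints σ) ∧
      -- the fixed locus as a cycle
      ∃ (n : ℕ) (T : Fin n → SmoothTorus φ), Parametrizes T (Function.fixedPoints σ) ∧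
        IsSLCayleyCycle x (∑ k, Finsupp.single (T k) (1 : ℚ)) ∧
      ∃ β : NumberField.RingOfIntegers (cmField x),
        ((β : cmField x) : ℂ) = Complex.I * (rootDisc x : ℂ) ∧
      ∃ Y Ca Ca' : Cycle φ,
        Y = ∑ k, Finsupp.single (T k) (1 : ℚ) ∧
        Ca = cycleOperator φ Δ (1 + β) β Y ∧
        Ca' = cycleOperator φ Δ (1 - β) β Y ∧
        IsSLCayleyCycle x Ca ∧ IsSLCayleyCycle x Ca' ∧
        PairsOnlyWithM Ca ∧ PairsOnlyWithM Ca' ∧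
        (Matrix.of ![![pairing Ca (fun _ => classM x), pairing Ca (fun _ => classM')],
          ![pairing Ca' (fun _ => classM x), pairing Ca' (fun _ => classM')]]).det ≠ 0 ∧
        (∃ r s : ℚ, Represents (r • Ca + s • Ca') (classM x)) ∧
        (∃ r s : ℚ, Represents (r • Ca + s • Ca') classM') := by
  have hP0 : P ≠ 0 := hirr.ne_zero
  have hdeg : P.natDegree ≤ 4 := by
    rw [hP]
    compute_degree
  have : NumberField (cmField x) := numberField_cmField hP0 hroot hΔ
  choose φ h1 h2 using exists_embedding hirr hroot hΔ
  let β : NumberField.RingOfIntegers (cmField x) := ⟨cmDisc x, isIntegral_cmDisc hΔ⟩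
  have hκ := coords_cmConj h1 h2
  have hconj : ∀ l ∈ lattice φ, conjE l ∈ lattice φ := fun l hl => conjE_mem_lattice hκ hl
  have hgen : IsCMGenerators φ x (cmRoot x) (β : cmField x) :=
    ⟨hx, h1, h2, finrank_cmField_le hP0 hdeg hx hroot hΔ⟩
  obtain ⟨g1, g2, g3, g4, n, T, g5, g6, Y, Ca, Ca', g7⟩ :=
    exists_cycles hgen hΔ (disc_ne_one hP0 hdeg hGal hx hroot hΔ) hconj
  refine ⟨φ, fun j y => ⟨fun hy => ?_, fun hy => ?_⟩, cmConj x, fun y => rfl, hκ, conjTorus hconj,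
    conjTorus_proj hconj, g1, g2, g3, g4, n, T, g5, g6, β, rfl, Y, Ca, Ca', g7⟩
  · rw [show y = cmRoot x from Subtype.ext hy, h1]
  · rw [show y = cmDisc x from Subtype.ext hy, h2]
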